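/- Let $5/3<\gamma\le 2$, let $f(z)=1+z^{\gamma-1}$, let $L_{min}=\frac32\,(\gamma-1)\,(\gamma-\tfrac23)^{-3/2}$, and let $L>0$ satisfy $L_{min}^2<L^2<1$. On $\Omega=\{(x,z):x>0,\ z>0\}$ consider $$H_L(x,z)=x^4z^2\Big(\frac{L^2}{f(z)^2}-1+\frac1x\Big)$$ and its Hamiltonian system $\dot x=\partial_zH_L$, $\dot z=-\partial_xH_L$. Let $c_1=\{(x,z)\in\Omega:\partial_xH_L(x,z)=0\}$. For a critical point $s$, let $W^s$ (resp. $W^u$) denote its global stable (resp. unstable) manifold, i.e. the set of points of $\Omega$ whose forward (resp. backward) orbit exists in $\Omega$ for all forward (resp. backward) times and converges to $s$. Then $H_L$ has exactly two critical points in $\Omega$: a saddle $s=(x_s,z_s)$ (Hessian determinant negative) and a center $c=(x_c,z_c)$ (Hessian determinant positive), and $x_s<x_c$. Moreover: 1. Every point $(x,z)$ of $W^s\cup W^u$ satisfies $x\le 1/(1-L^2)$. 2. There is a point $P$, with $x$-coordinate greater than $x_c$, such that $W^s\cap c_1=W^u\cap c_1=\{s,P\}$. 3. There is a homoclinic solution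 $\varphi:\mathbb R\to\Omega$ of the system with $\varphi(0)=P$: $\varphi(t)\ne s$ for all $t$ and $\varphi(t)\to s$ as $t\to\pm\infty$. It crosses $c_1$ at $P$: $\partial_xH_L(\varphi(t))>0$ for $t<0$ and $\partial_xH_L(\varphi(t))<0$ for $t>0$. The parts of $W^s$ and $W^u$ in $\{x>x_s\}$ coincide, and both are equal to the orbit $\varphi(\mathbb R)$. 4. Call a pair of functions $(z,u)$ on an interval $I\subseteq(0,\infty)$ an accretion solution with constants $\mu,L$ if $z>0$ and $u<0$ on $I$, $z$ and $u$ are continuous on $I$ and differentiable in its interior, and on $I$ $$x^2z(x)u(x)=\mu,\qquad f(z(x))^2\Big(1-\frac1x+u(x)^2\Big)=L^2.$$ There is $x_{max}$ with $x_c<x_{max}<1/(1-L^2)$ such that the homoclinic orbit $\varphi(\mathbb R)$ is the union of the graphs $x\mapsto(x,z_i(x))$, $x\in(x_s,x_{max}]$, $i=1,2$, of two accretion solutions $(z_1,u_1)$, $(z_2,u_2)$ on $(x_s,x_{max}]$ with constants $\mu=-\sqrt{H_L(s)}$ and $L$, where $z_2<z_1$ on $(x_s,x_{max})$ and $z_1(x_{max})=z_2(x_{max})$.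 Any accretion solution with constants $\mu$ (arbitrary) and $L$ on an interval $I$ whose graph contains a point of $W^s\cup W^u$ satisfies $I\subseteq(0,x_{max}]$. Hence it is local and not global: $I$ does not contain $(1,\infty)$. -/

import Mathlib

open Set Filter Topology

noncomputable section

namespace Michel

/-- Specific enthalpy of the polytropic fluid with adiabatic index `γ`, in dimensionless form. -/
def enthalpy (γ z : ℝ) : ℝ := 1 + z ^ (γ - 1)

/-- The threshold `L_min` above which critical points exist for `L < 1`. -/
def Lmin (γ : ℝ) : ℝ := 3 / 2 * ((γ - 1) / (γ - 2 / 3) ^ (3 / 2 : ℝ))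

/-- The Hamiltonian `H_L(x, z)` of the accretion problem. -/
def ham (γ L x z : ℝ) : ℝ := x ^ 4 * z ^ 2 * (L ^ 2 / enthalpy γ z ^ 2 - 1 + 1 / x)

/-- The phase space `x > 0`, `z > 0`. -/
def phaseSpace : Set (ℝ × ℝ) := {p | 0 < p.1 ∧ 0 < p.2}

/-- Partial derivative of a function of `(x, z)` with respect to `x`. -/
def partialX (H : ℝ → ℝ → ℝ) (x z : ℝ) : ℝ := deriv (fun x' => H x' z) x

/-- Partial derivative of a function of `(x, z)` with respect to `z`. -/
def partialZ (H : ℝ → ℝ → ℝ) (x z : ℝ) : ℝ := deriv (fun z' => H x z') z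

/-- The Hamiltonian vector field `(∂H/∂z, -∂H/∂x)`. -/
def hamField (H : ℝ → ℝ → ℝ) (p : ℝ × ℝ) : ℝ × ℝ :=
  (partialZ H p.1 p.2, -partialX H p.1 p.2)

/-- `φ` restricted to the set of times `S` is a solution of Hamilton's equations in phase space. -/
def IsSolutionOn (H : ℝ → ℝ → ℝ) (φ : ℝ → ℝ × ℝ) (S : Set ℝ) : Prop :=
  ∀ t ∈ S, φ t ∈ phaseSpace ∧ HasDerivWithinAt φ (hamField H (φ t)) S t

/-- Critical points of `H` in phase space. -/
def criticalPoints (H : ℝ → ℝ → ℝ) : Set (ℝ × ℝ) :=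
  {p | p ∈ phaseSpace ∧ partialX H p.1 p.2 = 0 ∧ partialZ H p.1 p.2 = 0}

/-- Determinant of the Hessian of `H`. -/
def hessianDet (H : ℝ → ℝ → ℝ) (p : ℝ × ℝ) : ℝ :=
  partialX (partialX H) p.1 p.2 * partialZ (partialZ H) p.1 p.2 -
    partialX (partialZ H) p.1 p.2 * partialZ (partialX H) p.1 p.2

/-- Saddle: a critical point at which the Hessian is indefinite. -/
def IsSaddle (H : ℝ → ℝ → ℝ) (p : ℝ × ℝ) : Prop :=
  p ∈ criticalPoints H ∧ hessianDet H p < 0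

/-- Center: a critical point at which the Hessian is definite (a nondegenerate extremum). -/
def IsCenter (H : ℝ → ℝ → ℝ) (p : ℝ × ℝ) : Prop :=
  p ∈ criticalPoints H ∧ 0 < hessianDet H p

/-- Global stable manifold of `s`: the points whose forward orbit converges to `s`. -/
def stableManifold (H : ℝ → ℝ → ℝ) (s : ℝ × ℝ) : Set (ℝ × ℝ) :=
  {p | ∃ φ : ℝ → ℝ × ℝ, φ 0 = p ∧ IsSolutionOn H φ (Ici 0) ∧ Tendsto φ atTop (𝓝 s)}

/-- Global unstable manifold of `s`: the points whose backward orbit converges to `s`. -/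
def unstableManifold (H : ℝ → ℝ → ℝ) (s : ℝ × ℝ) : Set (ℝ × ℝ) :=
  {p | ∃ φ : ℝ → ℝ × ℝ, φ 0 = p ∧ IsSolutionOn H φ (Iic 0) ∧ Tendsto φ atBot (𝓝 s)}

/-- The curve `c₁`: the points of phase space with vanishing `∂H/∂x`. -/
def curveC1 (H : ℝ → ℝ → ℝ) : Set (ℝ × ℝ) :=
  {p | p ∈ phaseSpace ∧ partialX H p.1 p.2 = 0}

/-- `φ` is a homoclinic solution of Hamilton's equations based at `s`: it exists for all times, is
not the equilibrium itself, and converges to `s` in both time directions. -/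
def IsHomoclinic (H : ℝ → ℝ → ℝ) (s : ℝ × ℝ) (φ : ℝ → ℝ × ℝ) : Prop :=
  IsSolutionOn H φ univ ∧ (∀ t, φ t ≠ s) ∧ Tendsto φ atBot (𝓝 s) ∧ Tendsto φ atTop (𝓝 s)

/-- Accretion solution on a radial interval `I` (`x` is the areal radius in units of the
Schwarzschild radius, so the horizon is `x = 1`): density `z > 0` and radial velocity `u < 0` obeying
the integrated conservation laws with constants `μ` and `L`. -/
structure IsAccretionSolution (γ L μ : ℝ) (I : Set ℝ) (z u : ℝ → ℝ) : Prop where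
  ordConnected : I.OrdConnected
  radius_pos : ∀ x ∈ I, 0 < x
  density_pos : ∀ x ∈ I, 0 < z x
  velocity_neg : ∀ x ∈ I, u x < 0
  continuousOn_density : ContinuousOn z I
  continuousOn_velocity : ContinuousOn u I
  differentiableOn_density : DifferentiableOn ℝ z (interior I)
  differentiableOn_velocity : DifferentiableOn ℝ u (interior I)
  particle_flux : ∀ x ∈ I, x ^ 2 * z x * u x = μ
  energy : ∀ x ∈ I, enthalpy γ (z x) ^ 2 * (1 - 1 / x + u x ^ 2) = L ^ 2

end Michel

end

/-!
Write `y = 1 / f(z)`. Then `∂H/∂x` and `∂H/∂z` vanish along two graphs `4 x g(z) = 3` and `x k(z) =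
1`, where `g` and `k` are increasing and `4 g - 3 k` is a cubic polynomial `q` in `y` (`critPoly`).
For `Lmin < L < 1` it has exactly two roots in `(0, 1)`, which are the critical points; the sign of
`q'` there is that of the Hessian determinant.

For fixed `z`, `H` is unimodal in `x` with maximum `ridge z` on the curve `∂H/∂x = 0`, and `ridge'`
has the sign of `q`. Hence `ridge` takes its value at the saddle at exactly one further height `zp`,
below that of the center. For fixed `x`, `H` increases in `z` below the curve `∂H/∂z = 0` and
decreases above it, so the vertical line through the saddle meets the saddle level only at the
saddle. The part of the level to the right of that line (`saddleLoop`) then lies at heights in `[zp,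
zs)`, where a point is determined by its height and its side of `∂H/∂x = 0`. No local invariant
manifold theory is needed: by conservation of energy both invariant manifolds lie on the saddle
level, so it suffices to find one orbit that fills the loop and converges to the saddle in both time
directions.

That orbit starts at the ridge point of height `zp`. It stays on the loop for all times, since the
loop is bounded and its closure adds only an equilibrium (`Heights.exists_loop_solution`). Where it
crosses `∂H/∂x = 0` or `∂H/∂z = 0` the transversal derivative has a fixed sign, so it crosses each
of the two curves exactly once (`LoopSolution.c1_of_pos`, `LoopSolution.exists_turning_time`). Both
coordinates are therefore eventually monotone and converge, and the limit is an equilibrium on the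
saddle level, hence the saddle (`Heights.limit_eq_saddle`). The two parts of the orbit before and
after the turning time of `x` are graphs over the radius and give the two accretion solutions
(`LoopSolution.exists_branches`). Along any accretion solution `H` equals `μ²`, so one that meets an
invariant manifold lies on the saddle level, which has no point beyond the turning radius.
-/

noncomputable section

namespace Michel

/-! ### One-dimensional calculus -/

/-- A differentiable function that can only cross zero upwards stays positive once it is
nonnegative. -/
theorem pos_of_deriv_pos_at_zeros {D D' : ℝ → ℝ} {a : ℝ} (hD : ∀ t, HasDerivAt D (D' t) t)
    (h : ∀ t ≥ a, D t = 0 → 0 < D' t) (ha : 0 ≤ D a) : ∀ t > a, 0 < D t := by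
  have hcont : Continuous D := continuous_iff_continuousAt.2 fun t => (hD t).continuousAt
  have hnonneg : ∀ t ≥ a, 0 ≤ D t := by
    intro t ht
    exact image_le_of_deriv_right_lt_deriv_boundary' (f := fun _ => (0 : ℝ)) (f' := fun _ => 0)
      continuousOn_const (fun x _ => hasDerivWithinAt_const ..) ha hcont.continuousOn
      (fun x _ => (hD x).hasDerivWithinAt) (fun x hx h0 => h x hx.1 h0.symm) ⟨ht, le_rfl⟩
  intro t ht
  refine (hnonneg t ht.le).lt_of_ne fun h0 => ?_
  have hslope := (hasDerivAt_iff_tendsto_slope.1 (hD t)).eventually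
    (eventually_gt_nhds (h t ht.le h0.symm))
  have hleft : ∀ᶠ s in 𝓝[<] t, 0 < slope D t s :=
    hslope.filter_mono (nhdsWithin_mono _ fun s hs => ne_of_lt hs)
  obtain ⟨s, hs, hsa, hst⟩ := (hleft.and (Ioo_mem_nhdsLT ht)).exists
  rw [slope_def_field, ← h0, sub_zero] at hs
  have hneg : D s / (s - t) ≤ 0 :=
    div_nonpos_of_nonneg_of_nonpos (hnonneg s hsa.le) (sub_nonpos.2 hst.le)
  exact absurd hs hneg.not_gt

/-- A differentiable function that can only cross zero upwards stays negative before any time at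
which it is nonpositive. -/
theorem neg_of_deriv_pos_at_zeros {D D' : ℝ → ℝ} {a : ℝ} (hD : ∀ t, HasDerivAt D (D' t) t)
    (h : ∀ t ≤ a, D t = 0 → 0 < D' t) (ha : D a ≤ 0) : ∀ t < a, D t < 0 := by
  intro t ht
  have hrev : ∀ s, HasDerivAt (fun r => -D (-r)) (D' (-s)) s := by
    intro s
    have := ((hD (-s)).comp s (hasDerivAt_neg s)).neg
    exact this.congr_deriv (by ring)
  have := pos_of_deriv_pos_at_zeros hrev (a := -a)
    (fun s hs h0 => h (-s) (by linarith) (by simpa using h0)) (by simpa using ha) (-t) (by linarith)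
  simpa using this

/-- If a function and its derivative both converge at infinity, the derivative converges to `0`. -/
theorem eq_zero_of_tendsto_deriv_atTop {f f' : ℝ → ℝ} {l m : ℝ}
    (hf : ∀ t, HasDerivAt f (f' t) t) (hl : Tendsto f atTop (𝓝 l))
    (hm : Tendsto f' atTop (𝓝 m)) : m = 0 := by
  have hmvt : ∀ t : ℝ, ∃ c ∈ Ioo t (t + 1), f' c = f (t + 1) - f t := by
    intro t
    obtain ⟨c, hc, h⟩ := exists_hasDerivAt_eq_slope f f' (lt_add_one t)
      (fun x _ => (hf x).continuousAt.continuousWithinAt) (fun x _ => hf x)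
    exact ⟨c, hc, by rw [h]; simp⟩
  choose c hc hfc using hmvt
  have hctop : Tendsto c atTop atTop := tendsto_atTop_mono (fun t => (hc t).1.le) tendsto_id
  have h1 : Tendsto (fun t => f' (c t)) atTop (𝓝 m) := hm.comp hctop
  have h2 : Tendsto (fun t => f (t + 1) - f t) atTop (𝓝 (l - l)) :=
    (hl.comp (tendsto_atTop_add_const_right _ 1 tendsto_id)).sub hl
  simp_rw [hfc] at h1
  simpa using tendsto_nhds_unique h1 h2

/-- A function monotone and bounded above on a half-line converges at infinity. -/
theorem exists_tendsto_of_monotoneOn {f : ℝ → ℝ} {a B : ℝ} (hf : MonotoneOn f (Ici a))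
    (hB : ∀ t ≥ a, f t ≤ B) : ∃ l, Tendsto f atTop (𝓝 l) := by
  have hmono : Monotone fun t => f (max a t) := fun s t hst =>
    hf (mem_Ici.2 (le_max_left _ _)) (mem_Ici.2 (le_max_left _ _)) (max_le_max le_rfl hst)
  have hbdd : BddAbove (range fun t => f (max a t)) :=
    ⟨B, by rintro _ ⟨t, rfl⟩; exact hB _ (le_max_left _ _)⟩
  refine ⟨_, (tendsto_atTop_ciSup hmono hbdd).congr' ?_⟩
  filter_upwards [eventually_ge_atTop a] with t ht
  rw [max_eq_right ht]

/-- A function antitone and bounded below on a half-line converges at infinity. -/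
theorem exists_tendsto_of_antitoneOn {f : ℝ → ℝ} {a B : ℝ} (hf : AntitoneOn f (Ici a))
    (hB : ∀ t ≥ a, B ≤ f t) : ∃ l, Tendsto f atTop (𝓝 l) := by
  obtain ⟨l, hl⟩ := exists_tendsto_of_monotoneOn (f := fun t => -f t) hf.neg
    fun t ht => neg_le_neg (hB t ht)
  exact ⟨-l, by simpa using hl.neg⟩

/-- Differentiable inverse of a function that increases strictly on `(-∞, T]` with nonvanishing
derivative before `T`. At the right end the inverse is only continuous. -/
theorem exists_inverse_of_strictMonoOn_Iic {f f' : ℝ → ℝ} {l T : ℝ}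
    (hf : ∀ t, HasDerivAt f (f' t) t) (hmono : StrictMonoOn f (Iic T)) (hf' : ∀ t < T, f' t ≠ 0)
    (hl : Tendsto f atBot (𝓝 l)) :
    ∃ g : ℝ → ℝ, ContinuousOn g (Ioc l (f T)) ∧ DifferentiableOn ℝ g (Ioo l (f T)) ∧
      (∀ x ∈ Ioc l (f T), g x ≤ T ∧ f (g x) = x) ∧
      ∀ t ≤ T, f t ∈ Ioc l (f T) ∧ g (f t) = t := by
  have hcont : Continuous f := continuous_iff_continuousAt.2 fun t => (hf t).continuousAt
  have hmaps : ∀ t ≤ T, f t ∈ Ioc l (f T) := by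
    intro t ht
    refine ⟨?_, hmono.monotoneOn ht self_mem_Iic ht⟩
    have h1 : f (t - 1) < f t := hmono (mem_Iic.2 (by linarith)) ht (by linarith)
    refine lt_of_le_of_lt (le_of_tendsto hl ?_) h1
    filter_upwards [eventually_le_atBot (t - 1)] with s hs
    exact hmono.monotoneOn (mem_Iic.2 (by linarith)) (mem_Iic.2 (by linarith)) hs
  have himg : f '' Iic T = Ioc l (f T) := by
    refine Subset.antisymm (by rintro _ ⟨t, ht, rfl⟩; exact hmaps t ht) fun x hx => ?_
    obtain ⟨s, hs, hsT⟩ := ((hl.eventually (eventually_lt_nhds hx.1)).and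
      (eventually_le_atBot T)).exists
    obtain ⟨t, ht, rfl⟩ := intermediate_value_Icc hsT hcont.continuousOn
      (show x ∈ Icc (f s) (f T) from ⟨hs.le, hx.2⟩)
    exact ⟨t, ht.2, rfl⟩
  let e := hmono.orderIso f (Iic T)
  have : OrdConnected (f '' Iic T) := himg ▸ ordConnected_Ioc
  let g := Function.invFunOn f (Iic T)
  have hg : ∀ x ∈ Ioc l (f T), g x ≤ T ∧ f (g x) = x := fun x hx =>
    ⟨Function.invFunOn_mem (himg ▸ hx : x ∈ f '' Iic T),
      Function.invFunOn_eq (himg ▸ hx : x ∈ f '' Iic T)⟩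
  have hgf : ∀ t ≤ T, g (f t) = t := fun t ht =>
    hmono.injOn (hg _ (hmaps t ht)).1 ht (hg _ (hmaps t ht)).2
  have hgc : ContinuousOn g (Ioc l (f T)) := by
    rw [← himg, continuousOn_iff_continuous_domRestrict]
    have heq : (f '' Iic T).domRestrict g = fun x => ((e.symm x : Iic T) : ℝ) := by
      funext x
      obtain ⟨⟨t, ht⟩, rfl⟩ := e.surjective x
      rw [OrderIso.symm_apply_apply]
      exact hgf t ht
    rw [heq]
    exact continuous_subtype_val.comp e.symm.continuous
  refine ⟨g, hgc, fun x hx => ?_, hg, fun t ht => ⟨hmaps t ht, hgf t ht⟩⟩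
  have hx' := Ioo_subset_Ioc_self hx
  have hlt : g x < T := (hg x hx').1.lt_of_ne fun he => by
    have := (hg x hx').2
    rw [he] at this
    exact hx.2.ne' this
  have hnhds : Ioo l (f T) ∈ 𝓝 x := isOpen_Ioo.mem_nhds hx
  refine (HasDerivAt.of_local_left_inverse
    (hgc.continuousAt (mem_of_superset hnhds Ioo_subset_Ioc_self)) (hf (g x)) (hf' _ hlt)
    ?_).differentiableAt.differentiableWithinAt
  filter_upwards [hnhds] with y hy using (hg y (Ioo_subset_Ioc_self hy)).2

/-! ### Global solutions of Lipschitz differential equations -/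

/-- A bounded, globally Lipschitz autonomous vector field has a global integral curve through every
point. -/
theorem exists_global_integralCurve {F : Type*} [NormedAddCommGroup F] [NormedSpace ℝ F]
    [CompleteSpace F] {v : F → F} {K C : NNReal} (hv : LipschitzWith K v) (hC : ∀ p, ‖v p‖ ≤ C)
    (p : F) : ∃ φ : ℝ → F, φ 0 = p ∧ ∀ t, HasDerivAt φ (v (φ t)) t := by
  have hloc : ∀ T : ℝ, 0 < T → ∃ α : ℝ → F, α 0 = p ∧
      ∀ t ∈ Icc (-T) T, HasDerivWithinAt α (v (α t)) (Icc (-T) T) t := by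
    intro T hT
    have hpl : IsPicardLindelof (fun _ => v) (tmin := -T) (tmax := T)
        ⟨0, by constructor <;> linarith⟩ p (C * T.toNNReal) 0 C K :=
      { lipschitzOnWith := fun _ _ => hv.lipschitzOnWith
        continuousOn := fun _ _ => continuousOn_const
        norm_le := fun _ _ x _ => hC x
        mul_max_le := by simp [Real.coe_toNNReal _ hT.le] }
    exact hpl.exists_eq_forall_mem_Icc_hasDerivWithinAt₀
  have hpos : ∀ t : ℝ, 0 < |t| + 1 := fun t => by positivity
  choose! α hα0 hα using hloc
  have hderiv : ∀ T, 0 < T → ∀ t ∈ Ioo (-T) T, HasDerivAt (α T) (v (α T t)) t := fun T hT t ht =>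
    (hα T hT t ⟨ht.1.le, ht.2.le⟩).hasDerivAt (Icc_mem_nhds ht.1 ht.2)
  have hagree : ∀ T T', 0 < T → T ≤ T' → EqOn (α T) (α T') (Ioo (-T) T) := by
    intro T T' hT hTT'
    exact ODE_solution_unique_of_mem_Ioo (v := fun _ => v) (s := fun _ => univ) (t₀ := 0)
      (fun _ _ => hv.lipschitzOnWith) ⟨by linarith, hT⟩
      (fun t ht => ⟨hderiv T hT t ht, mem_univ _⟩)
      (fun t ht => ⟨hderiv T' (hT.trans_le hTT') t ⟨by linarith [ht.1], by linarith [ht.2]⟩,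
        mem_univ _⟩)
      (by rw [hα0 T hT, hα0 T' (hT.trans_le hTT')])
  refine ⟨fun t => α (|t| + 1) t, by simpa using hα0 1 one_pos, fun t => ?_⟩
  have hself : ∀ t T : ℝ, |t| + 1 ≤ T → α (|t| + 1) t = α T t := fun t T hT =>
    hagree _ _ (hpos t) hT (abs_lt.1 (lt_add_one |t|))
  have hev : (fun r => α (|r| + 1) r) =ᶠ[𝓝 t] α (|t| + 2) := by
    filter_upwards [continuous_abs.continuousAt.eventually_lt continuousAt_const (lt_add_one |t|)]
      with r hr
    exact hself r _ (by linarith)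
  have h2 := hderiv (|t| + 2) (by positivity) t (abs_lt.1 (by linarith))
  simp only [hself t (|t| + 2) (by linarith)]
  exact h2.congr_of_eventuallyEq hev

/-- A `C¹` map on a compact box of the plane extends to a bounded, globally Lipschitz map, by
precomposition with the retraction onto the box. -/
theorem exists_lipschitz_extension_of_box {V : ℝ × ℝ → ℝ × ℝ} {a b c d : ℝ} (hab : a ≤ b)
    (hcd : c ≤ d) (hV : ContDiffOn ℝ 1 V (Icc a b ×ˢ Icc c d)) :
    ∃ (v : ℝ × ℝ → ℝ × ℝ) (K C : NNReal), LipschitzWith K v ∧ (∀ p, ‖v p‖ ≤ C) ∧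
      EqOn v V (Icc a b ×ˢ Icc c d) := by
  have hcomp : IsCompact (Icc a b ×ˢ Icc c d) := isCompact_Icc.prod isCompact_Icc
  obtain ⟨K, hK⟩ := (hV.locallyLipschitzOn
    ((convex_Icc a b).prod (convex_Icc c d))).exists_lipschitzOnWith_of_compact hcomp
  obtain ⟨C, hC⟩ := hcomp.exists_bound_of_continuousOn hV.continuousOn
  let r : ℝ × ℝ → ℝ × ℝ := fun p => (max a (min b p.1), max c (min d p.2))
  have hr : LipschitzWith 1 r := by
    have := ((LipschitzWith.prod_fst (α := ℝ) (β := ℝ)).const_min b |>.const_max a).prodMk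
      ((LipschitzWith.prod_snd (α := ℝ) (β := ℝ)).const_min d |>.const_max c)
    simpa using this
  have hmem : ∀ p, r p ∈ Icc a b ×ˢ Icc c d := fun p =>
    ⟨⟨le_max_left _ _, max_le hab (min_le_left _ _)⟩, le_max_left _ _, max_le hcd (min_le_left _ _)⟩
  have hfix : ∀ p ∈ Icc a b ×ˢ Icc c d, r p = p := by
    rintro ⟨x, z⟩ ⟨hx, hz⟩
    simp only [r, min_eq_right hx.2, max_eq_right hx.1, min_eq_right hz.2, max_eq_right hz.1]
  refine ⟨V ∘ r, K * 1, C.toNNReal, ?_, fun p => (hC _ (hmem p)).trans (Real.le_coe_toNNReal C),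
    fun p hp => by simp only [Function.comp, hfix p hp]⟩
  rw [← lipschitzOnWith_univ]
  exact hK.comp hr.lipschitzOnWith fun p _ => hmem p

/-! ### The Hamiltonian in terms of the reciprocal enthalpy -/

/-- The standing assumptions on the adiabatic index and on the constant `L`. -/
structure Admissible (γ L : ℝ) : Prop where
  gamma_gt : 5 / 3 < γ
  gamma_le : γ ≤ 2
  pos : 0 < L
  lmin_lt : Lmin γ ^ 2 < L ^ 2
  sq_lt_one : L ^ 2 < 1

/-- The reciprocal enthalpy `y = 1 / f(z)`, which decreases from `1` to `0` on `z > 0`. It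
replaces `z ^ (γ - 1)`: the curves below are polynomial in `y`, and so is `z y'(z)`. -/
def recipEnthalpy (γ z : ℝ) : ℝ := (enthalpy γ z)⁻¹

/-- The function `g` for which the curve `∂H/∂x = 0` is the graph `4 x g(z) = 3`. -/
def gCurve (γ L z : ℝ) : ℝ := 1 - L ^ 2 * recipEnthalpy γ z ^ 2

/-- The function `k` for which the curve `∂H/∂z = 0` is the graph `x k(z) = 1`. -/
def kCurve (γ L z : ℝ) : ℝ :=
  1 - L ^ 2 * ((2 - γ) * recipEnthalpy γ z ^ 2 + (γ - 1) * recipEnthalpy γ z ^ 3)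

/-- The polynomial in `y = 1 / f(z)` equal to `4 g - 3 k`; critical points correspond to its roots
in `(0, 1)`. -/
def critPoly (γ L y : ℝ) : ℝ := 1 - L ^ 2 * ((3 * γ - 2) * y ^ 2 - 3 * (γ - 1) * y ^ 3)

/-- The maximum over `x` of `H(x, z)`, that is, the value of `H` on the curve `∂H/∂x = 0` at
height `z`. -/
def ridge (γ L z : ℝ) : ℝ := 27 / 256 * (z ^ 2 / gCurve γ L z ^ 3)

variable {γ L x z : ℝ}

theorem four_gCurve_sub_three_kCurve (γ L z : ℝ) :
    4 * gCurve γ L z - 3 * kCurve γ L z = critPoly γ L (recipEnthalpy γ z) := by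
  unfold gCurve kCurve critPoly; ring

theorem ham_eq (γ L x z : ℝ) : ham γ L x z = z ^ 2 * (x ^ 3 - x ^ 4 * gCurve γ L z) := by
  unfold ham gCurve recipEnthalpy
  rcases eq_or_ne x 0 with rfl | hx
  · simp
  · field_simp
    ring

theorem one_lt_enthalpy (hz : 0 < z) : 1 < enthalpy γ z := by
  unfold enthalpy
  linarith [Real.rpow_pos_of_pos hz (γ - 1)]

theorem recipEnthalpy_pos (hz : 0 < z) : 0 < recipEnthalpy γ z :=
  inv_pos.2 (one_pos.trans (one_lt_enthalpy hz))

theorem recipEnthalpy_lt_one (hz : 0 < z) : recipEnthalpy γ z < 1 :=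
  inv_lt_one_of_one_lt₀ (one_lt_enthalpy hz)

theorem exists_recipEnthalpy_eq (hγ : 1 < γ) {y : ℝ} (hy : y ∈ Ioo (0 : ℝ) 1) :
    ∃ z > 0, recipEnthalpy γ z = y := by
  have h1 : 0 < y⁻¹ - 1 := sub_pos.2 ((one_lt_inv₀ hy.1).2 hy.2)
  refine ⟨(y⁻¹ - 1) ^ (γ - 1)⁻¹, Real.rpow_pos_of_pos h1 _, ?_⟩
  rw [recipEnthalpy, enthalpy, ← Real.rpow_mul h1.le, inv_mul_cancel₀ (by linarith), Real.rpow_one]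
  simp

theorem recipEnthalpy_strictAntiOn (hγ : 1 < γ) : StrictAntiOn (recipEnthalpy γ) (Ici 0) := by
  intro z₁ h₁ z₂ _ h
  have := Real.rpow_lt_rpow h₁ h (sub_pos.2 hγ)
  have h0 := Real.rpow_nonneg (mem_Ici.1 h₁) (γ - 1)
  unfold recipEnthalpy enthalpy
  gcongr

theorem continuousOn_recipEnthalpy (hγ : 1 < γ) : ContinuousOn (recipEnthalpy γ) (Ici 0) := by
  unfold recipEnthalpy enthalpy
  refine ContinuousOn.inv₀ (continuousOn_const.add
    (continuousOn_id.rpow_const fun z _ => Or.inr (sub_nonneg.2 hγ.le))) fun z hz => ?_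
  have := Real.rpow_nonneg (mem_Ici.1 hz) (γ - 1)
  positivity

theorem contDiffOn_recipEnthalpy (γ : ℝ) : ContDiffOn ℝ 2 (recipEnthalpy γ) (Ioi 0) := by
  unfold recipEnthalpy enthalpy
  refine ContDiffOn.inv (contDiffOn_const.add (contDiffOn_id.rpow_const_of_ne fun z hz => ?_))
    fun z hz => ?_
  · exact (mem_Ioi.1 hz).ne'
  · have := Real.rpow_pos_of_pos (mem_Ioi.1 hz) (γ - 1)
    positivity

theorem hasDerivAt_recipEnthalpy (hz : 0 < z) :
    HasDerivAt (recipEnthalpy γ)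
      (-((γ - 1) * recipEnthalpy γ z * (1 - recipEnthalpy γ z) / z)) z := by
  have h := ((Real.hasDerivAt_rpow_const (p := γ - 1) (Or.inl hz.ne')).const_add 1).inv
    (one_pos.trans (one_lt_enthalpy (γ := γ) hz)).ne'
  refine h.congr_deriv ?_
  have h2 : z ^ (γ - 1 - 1) = z ^ (γ - 1) / z := Real.rpow_sub_one hz.ne' _
  have h1 := Real.rpow_pos_of_pos hz (γ - 1)
  rw [h2, recipEnthalpy, enthalpy]
  field_simp
  ring

theorem hasDerivAt_gCurve (L : ℝ) (hz : 0 < z) :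
    HasDerivAt (gCurve γ L)
      (2 * L ^ 2 * (γ - 1) * recipEnthalpy γ z ^ 2 * (1 - recipEnthalpy γ z) / z) z := by
  have h := (((hasDerivAt_recipEnthalpy (γ := γ) hz).pow 2).const_mul (L ^ 2)).const_sub 1
  refine h.congr_deriv ?_
  push_cast
  ring

theorem hasDerivAt_kCurve (L : ℝ) (hz : 0 < z) :
    HasDerivAt (kCurve γ L)
      (L ^ 2 * (γ - 1) * recipEnthalpy γ z ^ 2 * (1 - recipEnthalpy γ z) *
        (2 * (2 - γ) + 3 * (γ - 1) * recipEnthalpy γ z) / z) z := by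
  have hy := hasDerivAt_recipEnthalpy (γ := γ) hz
  have h := ((((hy.pow 2).const_mul (2 - γ)).add ((hy.pow 3).const_mul (γ - 1))).const_mul
    (L ^ 2)).const_sub 1
  refine h.congr_deriv ?_
  push_cast
  ring

theorem hasDerivAt_ham_left (γ L x z : ℝ) :
    HasDerivAt (fun x' => ham γ L x' z) (x ^ 2 * z ^ 2 * (3 - 4 * x * gCurve γ L z)) x := by
  simp only [ham_eq]
  refine (((hasDerivAt_pow 3 x).sub ((hasDerivAt_pow 4 x).mul_const (gCurve γ L z))).const_mul
    (z ^ 2)).congr_deriv ?_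
  push_cast
  ring

theorem hasDerivAt_ham_right (L x : ℝ) (hz : 0 < z) :
    HasDerivAt (fun z' => ham γ L x z') (2 * x ^ 3 * z * (1 - x * kCurve γ L z)) z := by
  simp only [ham_eq]
  refine ((hasDerivAt_pow 2 z).mul (((hasDerivAt_gCurve L hz).const_mul (x ^ 4)).const_sub
    (x ^ 3))).congr_deriv ?_
  unfold kCurve gCurve
  field_simp
  push_cast
  ring

theorem partialX_ham (γ L x z : ℝ) :
    partialX (ham γ L) x z = x ^ 2 * z ^ 2 * (3 - 4 * x * gCurve γ L z) :=
  (hasDerivAt_ham_left γ L x z).deriv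

theorem partialZ_ham (L x : ℝ) (hz : 0 < z) :
    partialZ (ham γ L) x z = 2 * x ^ 3 * z * (1 - x * kCurve γ L z) :=
  (hasDerivAt_ham_right L x hz).deriv

/-- At a critical point the Hessian determinant is a positive multiple of the derivative of
`critPoly` at `y = 1 / f(z)`. -/
theorem hessianDet_ham_of_critical (hz : 0 < z) (hx : 0 < x) (h1 : 4 * x * gCurve γ L z = 3)
    (h2 : x * kCurve γ L z = 1) :
    hessianDet (ham γ L) (x, z) = 2 * L ^ 2 * (γ - 1) * recipEnthalpy γ z ^ 2 *
      (1 - recipEnthalpy γ z) * x ^ 5 * z ^ 2 *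
      (9 * (γ - 1) * recipEnthalpy γ z - 2 * (3 * γ - 2)) := by
  have hXX : partialX (partialX (ham γ L)) x z
      = 2 * x * z ^ 2 * (3 - 4 * x * gCurve γ L z) + x ^ 2 * z ^ 2 * (-(4 * gCurve γ L z)) := by
    unfold partialX
    have : (fun x' => deriv (fun x'' => ham γ L x'' z) x')
        = fun x' => x' ^ 2 * z ^ 2 * (3 - 4 * x' * gCurve γ L z) :=
      funext fun x' => (hasDerivAt_ham_left γ L x' z).deriv
    rw [this]
    refine (((hasDerivAt_pow 2 x).mul_const (z ^ 2)).mul ((((hasDerivAt_id x).const_mul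
      4).mul_const (gCurve γ L z)).const_sub 3)).deriv.trans ?_
    simp only [id]
    push_cast
    ring
  have hZZ : partialZ (partialZ (ham γ L)) x z = 2 * x ^ 3 * (1 - x * kCurve γ L z) -
      2 * x ^ 4 * (L ^ 2 * (γ - 1) * recipEnthalpy γ z ^ 2 * (1 - recipEnthalpy γ z) *
        (2 * (2 - γ) + 3 * (γ - 1) * recipEnthalpy γ z)) := by
    have hev : (fun z' => partialZ (ham γ L) x z')
        =ᶠ[𝓝 z] fun z' => 2 * x ^ 3 * z' * (1 - x * kCurve γ L z') := by
      filter_upwards [eventually_gt_nhds hz] with z' hz' using partialZ_ham L x hz'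
    refine (hev.deriv_eq).trans ((((hasDerivAt_id z).const_mul (2 * x ^ 3)).mul
      (((hasDerivAt_kCurve L hz).const_mul x).const_sub 1)).deriv.trans ?_)
    simp only [id]
    field_simp
    ring
  have hXZ : partialX (partialZ (ham γ L)) x z =
      6 * x ^ 2 * z * (1 - x * kCurve γ L z) - 2 * x ^ 3 * z * kCurve γ L z := by
    have hfun : (fun x' => partialZ (ham γ L) x' z)
        = fun x' => 2 * x' ^ 3 * z * (1 - x' * kCurve γ L z) :=
      funext fun x' => partialZ_ham L x' hz
    unfold partialX
    rw [hfun]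
    refine ((((hasDerivAt_pow 3 x).const_mul 2).mul_const z).mul
      (((hasDerivAt_id x).mul_const (kCurve γ L z)).const_sub 1)).deriv.trans ?_
    simp only [id]
    push_cast
    ring
  have hZX : partialZ (partialX (ham γ L)) x z =
      2 * x ^ 2 * z * (3 - 4 * x * gCurve γ L z) - 4 * x ^ 3 * z *
        (2 * L ^ 2 * (γ - 1) * recipEnthalpy γ z ^ 2 * (1 - recipEnthalpy γ z)) := by
    have hfun : (fun z' => partialX (ham γ L) x z')
        = fun z' => x ^ 2 * z' ^ 2 * (3 - 4 * x * gCurve γ L z') :=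
      funext fun z' => partialX_ham γ L x z'
    unfold partialZ
    rw [hfun]
    refine (((hasDerivAt_pow 2 z).const_mul (x ^ 2)).mul
      (((hasDerivAt_gCurve L hz).const_mul (4 * x)).const_sub 3)).deriv.trans ?_
    field_simp
    push_cast
    ring
  have hg : gCurve γ L z = 3 / (4 * x) := by field_simp; linarith
  have hk : kCurve γ L z = 1 / x := by field_simp; linarith
  simp only [hessianDet, hXX, hZZ, hXZ, hZX, hg, hk]
  field_simp
  ring

/-! ### Shape of the curves `∂H/∂x = 0` and `∂H/∂z = 0` -/

theorem lt_gCurve (hL : 0 < L) (hz : 0 < z) : 1 - L ^ 2 < gCurve γ L z := by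
  have h1 := recipEnthalpy_lt_one (γ := γ) hz
  have h0 := recipEnthalpy_pos (γ := γ) hz
  unfold gCurve
  nlinarith [pow_pos hL 2, mul_pos (pow_pos hL 2) (sub_pos.2 (pow_lt_one₀ h0.le h1 two_ne_zero))]

namespace Admissible

theorem one_lt (h : Admissible γ L) : 1 < γ := by linarith [h.gamma_gt]

theorem gCurve_pos (h : Admissible γ L) (hz : 0 < z) : 0 < gCurve γ L z :=
  (sub_pos.2 h.sq_lt_one).trans (lt_gCurve h.pos hz)

theorem gCurve_strictMonoOn (h : Admissible γ L) : StrictMonoOn (gCurve γ L) (Ici 0) := by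
  intro z₁ h₁ z₂ h₂ h12
  have hy := recipEnthalpy_strictAntiOn h.one_lt h₁ h₂ h12
  have h0 := recipEnthalpy_pos (γ := γ) (lt_of_le_of_lt (mem_Ici.1 h₁) h12)
  have hL := pow_pos h.pos 2
  unfold gCurve
  gcongr

theorem kCurve_strictMonoOn (h : Admissible γ L) : StrictMonoOn (kCurve γ L) (Ici 0) := by
  intro z₁ h₁ z₂ h₂ h12
  have hy := recipEnthalpy_strictAntiOn h.one_lt h₁ h₂ h12
  have h0 := recipEnthalpy_pos (γ := γ) (lt_of_le_of_lt (mem_Ici.1 h₁) h12)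
  have hL := pow_pos h.pos 2
  have h2 : 0 ≤ 2 - γ := sub_nonneg.2 h.gamma_le
  have h3 : 0 < γ - 1 := sub_pos.2 h.one_lt
  have h4 : (2 - γ) * recipEnthalpy γ z₂ ^ 2 + (γ - 1) * recipEnthalpy γ z₂ ^ 3 <
      (2 - γ) * recipEnthalpy γ z₁ ^ 2 + (γ - 1) * recipEnthalpy γ z₁ ^ 3 :=
    add_lt_add_of_le_of_lt (by gcongr) (by gcongr)
  unfold kCurve
  gcongr

theorem continuousOn_gCurve (h : Admissible γ L) : ContinuousOn (gCurve γ L) (Ici 0) :=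
  continuousOn_const.sub (continuousOn_const.mul ((continuousOn_recipEnthalpy h.one_lt).pow 2))

/-- For fixed `z`, `H` increases in `x` up to the curve `∂H/∂x = 0`. -/
theorem ham_lt_ham_of_left (h : Admissible γ L) {x₁ x₂ : ℝ} (hz : 0 < z) (h1 : 0 < x₁)
    (h12 : x₁ < x₂) (h2 : 4 * x₂ * gCurve γ L z ≤ 3) : ham γ L x₁ z < ham γ L x₂ z := by
  have hg := h.gCurve_pos hz
  have : StrictMonoOn (fun x => ham γ L x z) (Icc x₁ x₂) := by
    refine strictMonoOn_of_hasDerivWithinAt_pos (convex_Icc _ _)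
      (fun x _ => (hasDerivAt_ham_left γ L x z).continuousAt.continuousWithinAt)
      (fun x _ => (hasDerivAt_ham_left γ L x z).hasDerivWithinAt) fun x hx => ?_
    rw [interior_Icc] at hx
    have hx0 : 0 < x := h1.trans hx.1
    have : 4 * x * gCurve γ L z < 4 * x₂ * gCurve γ L z := by gcongr; exact hx.2
    have : 0 < 3 - 4 * x * gCurve γ L z := by linarith
    positivity
  exact this ⟨le_rfl, h12.le⟩ ⟨h12.le, le_rfl⟩ h12

/-- For fixed `z`, `H` decreases in `x` beyond the curve `∂H/∂x = 0`. -/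
theorem ham_lt_ham_of_right (h : Admissible γ L) {x₁ x₂ : ℝ} (hz : 0 < z) (h1 : 0 < x₁)
    (h12 : x₁ < x₂) (h2 : 3 ≤ 4 * x₁ * gCurve γ L z) : ham γ L x₂ z < ham γ L x₁ z := by
  have hg := h.gCurve_pos hz
  have : StrictAntiOn (fun x => ham γ L x z) (Icc x₁ x₂) := by
    refine strictAntiOn_of_hasDerivWithinAt_neg (convex_Icc _ _)
      (fun x _ => (hasDerivAt_ham_left γ L x z).continuousAt.continuousWithinAt)
      (fun x _ => (hasDerivAt_ham_left γ L x z).hasDerivWithinAt) fun x hx => ?_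
    rw [interior_Icc] at hx
    have hx0 : 0 < x := h1.trans hx.1
    have : 4 * x₁ * gCurve γ L z < 4 * x * gCurve γ L z := by gcongr; exact hx.1
    exact mul_neg_of_pos_of_neg (by positivity) (by linarith)
  exact this ⟨le_rfl, h12.le⟩ ⟨h12.le, le_rfl⟩ h12

/-- For fixed `x`, `H` increases in `z` up to the curve `∂H/∂z = 0`. -/
theorem ham_lt_ham_of_below (h : Admissible γ L) {z₁ z₂ : ℝ} (hx : 0 < x) (h1 : 0 < z₁)
    (h12 : z₁ < z₂) (h2 : x * kCurve γ L z₂ ≤ 1) : ham γ L x z₁ < ham γ L x z₂ := by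
  have : StrictMonoOn (fun z => ham γ L x z) (Icc z₁ z₂) := by
    refine strictMonoOn_of_hasDerivWithinAt_pos (convex_Icc _ _)
      (fun z hz => (hasDerivAt_ham_right L x
        (h1.trans_le hz.1)).continuousAt.continuousWithinAt)
      (fun z hz => (hasDerivAt_ham_right L x
        (h1.trans_le (interior_subset hz).1)).hasDerivWithinAt) fun z hz => ?_
    rw [interior_Icc] at hz
    have hz0 : 0 < z := h1.trans hz.1
    have : x * kCurve γ L z < x * kCurve γ L z₂ := by
      gcongr; exact h.kCurve_strictMonoOn hz0.le (h1.trans h12).le hz.2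
    have : 0 < 1 - x * kCurve γ L z := by linarith
    positivity
  exact this ⟨le_rfl, h12.le⟩ ⟨h12.le, le_rfl⟩ h12

/-- For fixed `x`, `H` decreases in `z` above the curve `∂H/∂z = 0`. -/
theorem ham_lt_ham_of_above (h : Admissible γ L) {z₁ z₂ : ℝ} (hx : 0 < x) (h1 : 0 < z₁)
    (h12 : z₁ < z₂) (h2 : 1 ≤ x * kCurve γ L z₁) : ham γ L x z₂ < ham γ L x z₁ := by
  have : StrictAntiOn (fun z => ham γ L x z) (Icc z₁ z₂) := by
    refine strictAntiOn_of_hasDerivWithinAt_neg (convex_Icc _ _)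
      (fun z hz => (hasDerivAt_ham_right L x
        (h1.trans_le hz.1)).continuousAt.continuousWithinAt)
      (fun z hz => (hasDerivAt_ham_right L x
        (h1.trans_le (interior_subset hz).1)).hasDerivWithinAt) fun z hz => ?_
    rw [interior_Icc] at hz
    have hz0 : 0 < z := h1.trans hz.1
    have : x * kCurve γ L z₁ < x * kCurve γ L z := by
      gcongr; exact h.kCurve_strictMonoOn h1.le hz0.le hz.1
    exact mul_neg_of_pos_of_neg (by positivity) (by linarith)
  exact this ⟨le_rfl, h12.le⟩ ⟨h12.le, le_rfl⟩ h12

theorem ham_eq_ridge (h : Admissible γ L) (hz : 0 < z) (hx : 4 * x * gCurve γ L z = 3) :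
    ham γ L x z = ridge γ L z := by
  have hg := h.gCurve_pos hz
  have : x = 3 / (4 * gCurve γ L z) := by field_simp; linarith
  rw [ham_eq, ridge, this]
  field_simp
  ring

theorem ham_lt_ridge (h : Admissible γ L) (hz : 0 < z) (hx : 0 < x)
    (hne : 4 * x * gCurve γ L z ≠ 3) : ham γ L x z < ridge γ L z := by
  have hg := h.gCurve_pos hz
  have h0 : 4 * (3 / (4 * gCurve γ L z)) * gCurve γ L z = 3 := by field_simp
  rw [← h.ham_eq_ridge hz h0]
  rcases hne.lt_or_gt with h1 | h1
  · refine h.ham_lt_ham_of_left hz hx ?_ h0.le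
    rw [lt_div_iff₀ (by positivity)]; linarith
  · refine h.ham_lt_ham_of_right hz (by positivity) ?_ h0.ge
    rw [div_lt_iff₀ (by positivity)]; linarith

theorem ham_le_ridge (h : Admissible γ L) (hz : 0 < z) (hx : 0 < x) :
    ham γ L x z ≤ ridge γ L z := by
  by_cases h0 : 4 * x * gCurve γ L z = 3
  · exact (h.ham_eq_ridge hz h0).le
  · exact (h.ham_lt_ridge hz hx h0).le

theorem lt_of_ham_pos (h : Admissible γ L) (hz : 0 < z) (hx : 0 < x) (hH : 0 < ham γ L x z) :
    x < 1 / (1 - L ^ 2) := by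
  have h1 := sub_pos.2 h.sq_lt_one
  have h2 := lt_gCurve (γ := γ) h.pos hz
  rw [lt_div_iff₀ h1]
  by_contra! hcon
  rw [ham_eq] at hH
  have h3 : 1 < x * gCurve γ L z := hcon.trans_lt (by gcongr)
  have h4 : x ^ 3 - x ^ 4 * gCurve γ L z = x ^ 3 * (1 - x * gCurve γ L z) := by ring
  have h5 : x ^ 3 * (1 - x * gCurve γ L z) < 0 :=
    mul_neg_of_pos_of_neg (by positivity) (by linarith)
  rw [h4] at hH
  exact absurd hH (mul_nonpos_of_nonneg_of_nonpos (by positivity) h5.le).not_gt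

/-- The ridge value is stationary exactly where `4 g - 3 k` vanishes, that is, at critical
points. -/
theorem hasDerivAt_ridge (h : Admissible γ L) (hz : 0 < z) :
    HasDerivAt (ridge γ L) (27 / 128 * z * critPoly γ L (recipEnthalpy γ z) / gCurve γ L z ^ 4)
      z := by
  have hg := h.gCurve_pos hz
  refine (((hasDerivAt_pow 2 z).div ((hasDerivAt_gCurve L hz).pow 3)
    (pow_pos hg 3).ne').const_mul (27 / 256)).congr_deriv ?_
  have : critPoly γ L (recipEnthalpy γ z) = gCurve γ L z -
      3 * L ^ 2 * (γ - 1) * recipEnthalpy γ z ^ 2 * (1 - recipEnthalpy γ z) := by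
    unfold critPoly gCurve; ring
  rw [this]
  simp only [Pi.pow_apply]
  field_simp
  push_cast
  ring

end Admissible

/-! ### The two critical points -/

theorem hasDerivAt_critPoly (γ L y : ℝ) : HasDerivAt (critPoly γ L)
    (L ^ 2 * y * (9 * (γ - 1) * y - 2 * (3 * γ - 2))) y := by
  refine ((((hasDerivAt_pow 2 y).const_mul (3 * γ - 2)).sub
    ((hasDerivAt_pow 3 y).const_mul (3 * (γ - 1)))).const_mul (L ^ 2)).const_sub 1
      |>.congr_deriv ?_
  push_cast
  ring

theorem Lmin_sq (hγ : 2 / 3 < γ) : Lmin γ ^ 2 = 9 / 4 * ((γ - 1) ^ 2 / (γ - 2 / 3) ^ 3) := by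
  have h0 : 0 ≤ γ - 2 / 3 := by linarith
  have : ((γ - 2 / 3) ^ (3 / 2 : ℝ)) ^ 2 = (γ - 2 / 3) ^ 3 := by
    rw [← Real.rpow_natCast, ← Real.rpow_mul h0, ← Real.rpow_natCast]
    norm_num
  rw [Lmin, mul_pow, div_pow _ ((γ - 2 / 3) ^ (3 / 2 : ℝ)), this]
  norm_num

/-- `Lmin` is the threshold beyond which the minimum of `critPoly` over `y > 0`, attained at
`y = 2 (3 γ - 2) / (9 (γ - 1))`, is negative. -/
theorem Admissible.critPoly_min_neg (h : Admissible γ L) :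
    critPoly γ L (2 * (3 * γ - 2) / (9 * (γ - 1))) < 0 := by
  have h1 : 0 < γ - 1 := sub_pos.2 h.one_lt
  have h2 : 0 < γ - 2 / 3 := by linarith
  have h3 := h.lmin_lt
  rw [Lmin_sq (by linarith), ← mul_div_assoc, div_lt_iff₀ (by positivity)] at h3
  have h4 : critPoly γ L (2 * (3 * γ - 2) / (9 * (γ - 1))) =
      1 - L ^ 2 * (γ - 2 / 3) ^ 3 / (9 / 4 * (γ - 1) ^ 2) := by
    unfold critPoly
    field_simp
    ring
  rw [h4, sub_neg, lt_div_iff₀ (by positivity)]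
  linarith

theorem Admissible.exists_critPoly_roots (h : Admissible γ L) : ∃ ys yc : ℝ,
    ys ∈ Ioo (0 : ℝ) 1 ∧ yc ∈ Ioo (0 : ℝ) 1 ∧ ys < yc ∧
    critPoly γ L ys = 0 ∧ critPoly γ L yc = 0 ∧
    (∀ y ∈ Ioo 0 ys, 0 < critPoly γ L y) ∧ (∀ y ∈ Ioo ys yc, critPoly γ L y < 0) ∧
    (∀ y ∈ Ioo yc 1, 0 < critPoly γ L y) ∧
    9 * (γ - 1) * ys < 2 * (3 * γ - 2) ∧ 2 * (3 * γ - 2) < 9 * (γ - 1) * yc := by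
  have h1 : 0 < γ - 1 := sub_pos.2 h.one_lt
  have hb : 0 < 3 * γ - 2 := by linarith
  have hL := pow_pos h.pos 2
  set y₀ := 2 * (3 * γ - 2) / (9 * (γ - 1)) with hy₀
  have hy₀0 : 0 < y₀ := by positivity
  have hy₀1 : y₀ < 1 := by
    rw [hy₀, div_lt_one (by positivity)]
    linarith [h.gamma_gt]
  have hmul : 9 * (γ - 1) * y₀ = 2 * (3 * γ - 2) := by rw [hy₀]; field_simp
  have hcont : Continuous (critPoly γ L) :=
    continuous_iff_continuousAt.2 fun y => (hasDerivAt_critPoly γ L y).continuousAt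
  have hanti : StrictAntiOn (critPoly γ L) (Icc 0 y₀) := by
    refine strictAntiOn_of_hasDerivWithinAt_neg (convex_Icc _ _) hcont.continuousOn
      (fun y _ => (hasDerivAt_critPoly γ L y).hasDerivWithinAt) fun y hy => ?_
    rw [interior_Icc] at hy
    have : 9 * (γ - 1) * y < 9 * (γ - 1) * y₀ := by gcongr; exact hy.2
    exact mul_neg_of_pos_of_neg (mul_pos hL hy.1) (by linarith)
  have hmono : StrictMonoOn (critPoly γ L) (Icc y₀ 1) := by
    refine strictMonoOn_of_hasDerivWithinAt_pos (convex_Icc _ _) hcont.continuousOn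
      (fun y _ => (hasDerivAt_critPoly γ L y).hasDerivWithinAt) fun y hy => ?_
    rw [interior_Icc] at hy
    have : 9 * (γ - 1) * y₀ < 9 * (γ - 1) * y := by gcongr; exact hy.1
    exact mul_pos (mul_pos hL (hy₀0.trans hy.1)) (by linarith)
  have h0 : critPoly γ L 0 = 1 := by simp [critPoly]
  have h11 : 0 < critPoly γ L 1 := by
    have : critPoly γ L 1 = 1 - L ^ 2 := by unfold critPoly; ring
    rw [this]; exact sub_pos.2 h.sq_lt_one
  have hneg : critPoly γ L y₀ < 0 := h.critPoly_min_neg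
  obtain ⟨ys, hys, hqs⟩ := intermediate_value_Icc' hy₀0.le hcont.continuousOn
    (show (0 : ℝ) ∈ Icc (critPoly γ L y₀) (critPoly γ L 0) from ⟨hneg.le, by rw [h0]; simp⟩)
  obtain ⟨yc, hyc, hqc⟩ := intermediate_value_Icc hy₀1.le hcont.continuousOn
    (show (0 : ℝ) ∈ Icc (critPoly γ L y₀) (critPoly γ L 1) from ⟨hneg.le, h11.le⟩)
  have hys0 : 0 < ys := hys.1.lt_of_ne (by rintro rfl; simp [h0] at hqs)
  have hysy : ys < y₀ := hys.2.lt_of_ne (by rintro rfl; simp [hqs] at hneg)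
  have hycy : y₀ < yc := hyc.1.lt_of_ne' (by rintro rfl; simp [hqc] at hneg)
  have hyc1 : yc < 1 := hyc.2.lt_of_ne (by rintro rfl; simp [hqc] at h11)
  refine ⟨ys, yc, ⟨hys0, hysy.trans hy₀1⟩, ⟨hy₀0.trans hycy, hyc1⟩, hysy.trans hycy, hqs, hqc,
    fun y hy => ?_, fun y hy => ?_, fun y hy => ?_, ?_, ?_⟩
  · rw [← hqs]
    exact hanti ⟨hy.1.le, (hy.2.trans hysy).le⟩ hys hy.2
  · rcases le_total y y₀ with hle | hle
    · rw [← hqs]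
      exact hanti hys ⟨(hys0.trans hy.1).le, hle⟩ hy.1
    · rw [← hqc]
      exact hmono ⟨hle, (hy.2.trans hyc1).le⟩ hyc hy.2
  · rw [← hqc]
    exact hmono hyc ⟨(hycy.trans hy.1).le, hy.2.le⟩ hy.1
  · rw [← hmul]; gcongr
  · rw [← hmul]; gcongr

/-- The heights of the distinguished points: `zc` and `zs` are the heights of the center and of the
saddle, and `zp < zc` is the height at which the ridge takes the saddle value again. -/
structure Heights (γ L zp zc zs : ℝ) : Prop extends Admissible γ L where
  zp_pos : 0 < zp
  zp_lt_zc : zp < zc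
  zc_lt_zs : zc < zs
  critPoly_zc : critPoly γ L (recipEnthalpy γ zc) = 0
  critPoly_zs : critPoly γ L (recipEnthalpy γ zs) = 0
  critPoly_pos_of_lt : ∀ z > 0, z < zc → 0 < critPoly γ L (recipEnthalpy γ z)
  critPoly_neg : ∀ z, zc < z → z < zs → critPoly γ L (recipEnthalpy γ z) < 0
  critPoly_pos_of_gt : ∀ z, zs < z → 0 < critPoly γ L (recipEnthalpy γ z)
  slope_zc : 2 * (3 * γ - 2) < 9 * (γ - 1) * recipEnthalpy γ zc
  slope_zs : 9 * (γ - 1) * recipEnthalpy γ zs < 2 * (3 * γ - 2)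
  ridge_zp : ridge γ L zp = ridge γ L zs

theorem Admissible.ridge_strictMonoOn (h : Admissible γ L) {I : Set ℝ} (hI : Convex ℝ I)
    (hIpos : ∀ z ∈ I, 0 < z) (hq : ∀ z ∈ interior I, 0 < critPoly γ L (recipEnthalpy γ z)) :
    StrictMonoOn (ridge γ L) I := by
  refine strictMonoOn_of_hasDerivWithinAt_pos hI
    (fun z hz => (h.hasDerivAt_ridge (hIpos z hz)).continuousAt.continuousWithinAt)
    (fun z hz => (h.hasDerivAt_ridge (hIpos z (interior_subset hz))).hasDerivWithinAt)
    fun z hz => ?_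
  have h1 := hIpos z (interior_subset hz)
  have h2 := h.gCurve_pos h1
  have h3 := hq z hz
  positivity

theorem Admissible.ridge_strictAntiOn (h : Admissible γ L) {I : Set ℝ} (hI : Convex ℝ I)
    (hIpos : ∀ z ∈ I, 0 < z) (hq : ∀ z ∈ interior I, critPoly γ L (recipEnthalpy γ z) < 0) :
    StrictAntiOn (ridge γ L) I := by
  refine strictAntiOn_of_hasDerivWithinAt_neg hI
    (fun z hz => (h.hasDerivAt_ridge (hIpos z hz)).continuousAt.continuousWithinAt)
    (fun z hz => (h.hasDerivAt_ridge (hIpos z (interior_subset hz))).hasDerivWithinAt)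
    fun z hz => ?_
  have h1 := hIpos z (interior_subset hz)
  have h2 := h.gCurve_pos h1
  have h3 := hq z hz
  exact div_neg_of_neg_of_pos (mul_neg_of_pos_of_neg (by positivity) h3) (by positivity)

theorem Admissible.exists_heights (h : Admissible γ L) : ∃ zp zc zs, Heights γ L zp zc zs := by
  obtain ⟨ys, yc, hys, hyc, hlt, hqs, hqc, hq1, hq2, hq3, hsl, hcl⟩ := h.exists_critPoly_roots
  obtain ⟨zs, hzs, rfl⟩ := exists_recipEnthalpy_eq h.one_lt hys
  obtain ⟨zc, hzc, rfl⟩ := exists_recipEnthalpy_eq h.one_lt hyc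
  have hanti := recipEnthalpy_strictAntiOn h.one_lt
  have hcs : zc < zs := (hanti.lt_iff_gt hzs.le hzc.le).1 hlt
  have hpos1 : ∀ z > 0, z < zc → 0 < critPoly γ L (recipEnthalpy γ z) := fun z hz hzlt =>
    hq3 _ ⟨hanti hz.le hzc.le hzlt, recipEnthalpy_lt_one hz⟩
  have hneg : ∀ z, zc < z → z < zs → critPoly γ L (recipEnthalpy γ z) < 0 := fun z h1 h2 =>
    hq2 _ ⟨hanti (hzc.trans h1).le hzs.le h2, hanti hzc.le (hzc.trans h1).le h1⟩
  have hpos2 : ∀ z, zs < z → 0 < critPoly γ L (recipEnthalpy γ z) := fun z h1 =>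
    hq1 _ ⟨recipEnthalpy_pos (hzs.trans h1), hanti hzs.le (hzs.trans h1).le h1⟩
  have hridge : ridge γ L zs < ridge γ L zc :=
    h.ridge_strictAntiOn (convex_Icc zc zs) (fun z hz => lt_of_lt_of_le hzc hz.1)
      (fun z hz => by rw [interior_Icc] at hz; exact hneg z hz.1 hz.2)
      ⟨le_rfl, hcs.le⟩ ⟨hcs.le, le_rfl⟩ hcs
  have hs0 : 0 < ridge γ L zs := by
    have := h.gCurve_pos hzs
    unfold ridge
    positivity
  -- the ridge function is continuous down to `z = 0`, where it vanishes
  have hg0 : ∀ z ∈ Icc 0 zc, gCurve γ L z ^ 3 ≠ 0 := by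
    intro z hz
    refine pow_ne_zero 3 (ne_of_gt ?_)
    have h0 : 0 < gCurve γ L 0 := by
      have : recipEnthalpy γ 0 = 1 := by
        simp [recipEnthalpy, enthalpy, Real.zero_rpow (sub_pos.2 h.one_lt).ne']
      rw [gCurve, this]
      linarith [h.sq_lt_one]
    exact h0.trans_le (h.gCurve_strictMonoOn.monotoneOn self_mem_Ici hz.1 hz.1)
  have hcont : ContinuousOn (ridge γ L) (Icc 0 zc) :=
    continuousOn_const.mul ((continuousOn_id.pow 2).div
      ((h.continuousOn_gCurve.mono Icc_subset_Ici_self).pow 3) hg0)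
  obtain ⟨zp, hzp, hrp⟩ := intermediate_value_Icc hzc.le hcont
    (show ridge γ L zs ∈ Icc (ridge γ L 0) (ridge γ L zc) from
      ⟨by simpa [ridge] using hs0.le, hridge.le⟩)
  refine ⟨zp, zc, zs, h, hzp.1.lt_of_ne ?_, hzp.2.lt_of_ne ?_, hcs, hqc, hqs, hpos1, hneg, hpos2,
    hcl, hsl, hrp⟩
  · rintro rfl
    have : ridge γ L 0 = 0 := by simp [ridge]
    linarith
  · rintro rfl
    exact hridge.ne' hrp

/-- The point of the curve `∂H/∂x = 0` at height `z`. -/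
def ridgePoint (γ L z : ℝ) : ℝ × ℝ := (3 / (4 * gCurve γ L z), z)

theorem Admissible.ridgePoint_fst_pos (h : Admissible γ L) (hz : 0 < z) :
    0 < (ridgePoint γ L z).1 := by
  have := h.gCurve_pos hz
  simp only [ridgePoint]
  positivity

theorem Admissible.ridgePoint_spec (h : Admissible γ L) (hz : 0 < z) :
    4 * (ridgePoint γ L z).1 * gCurve γ L z = 3 := by
  have := h.gCurve_pos hz
  simp only [ridgePoint]
  field_simp

theorem Admissible.eq_ridgePoint (h : Admissible γ L) {p : ℝ × ℝ} (hz : 0 < p.2)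
    (hp : 4 * p.1 * gCurve γ L p.2 = 3) : p = ridgePoint γ L p.2 := by
  have := h.gCurve_pos hz
  refine Prod.ext ?_ rfl
  simp only [ridgePoint]
  field_simp
  linarith

theorem Admissible.ridgePoint_fst_lt (h : Admissible γ L) {z₁ z₂ : ℝ} (h1 : 0 < z₁)
    (h12 : z₁ < z₂) : (ridgePoint γ L z₂).1 < (ridgePoint γ L z₁).1 := by
  have := h.gCurve_pos h1
  have := h.gCurve_strictMonoOn h1.le (h1.trans h12).le h12
  simp only [ridgePoint]
  gcongr

theorem Admissible.ham_ridgePoint (h : Admissible γ L) (hz : 0 < z) :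
    ham γ L (ridgePoint γ L z).1 z = ridge γ L z :=
  h.ham_eq_ridge hz (h.ridgePoint_spec hz)

theorem partialX_ham_eq_zero_iff {p : ℝ × ℝ} (hp : p ∈ phaseSpace) :
    partialX (ham γ L) p.1 p.2 = 0 ↔ 4 * p.1 * gCurve γ L p.2 = 3 := by
  have h1 : 0 < p.1 := hp.1
  have h2 : 0 < p.2 := hp.2
  rw [partialX_ham, mul_eq_zero_iff_left (by positivity), sub_eq_zero, eq_comm]

theorem partialZ_ham_eq_zero_iff {p : ℝ × ℝ} (hp : p ∈ phaseSpace) :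
    partialZ (ham γ L) p.1 p.2 = 0 ↔ p.1 * kCurve γ L p.2 = 1 := by
  have h1 : 0 < p.1 := hp.1
  have h2 : 0 < p.2 := hp.2
  rw [partialZ_ham L p.1 h2, mul_eq_zero_iff_left (by positivity), sub_eq_zero, eq_comm]

theorem partialX_ham_pos_iff {p : ℝ × ℝ} (hp : p ∈ phaseSpace) :
    0 < partialX (ham γ L) p.1 p.2 ↔ 4 * p.1 * gCurve γ L p.2 < 3 := by
  have h1 : 0 < p.1 := hp.1
  have h2 : 0 < p.2 := hp.2
  rw [partialX_ham, mul_pos_iff_of_pos_left (by positivity), sub_pos]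

theorem partialX_ham_neg_iff {p : ℝ × ℝ} (hp : p ∈ phaseSpace) :
    partialX (ham γ L) p.1 p.2 < 0 ↔ 3 < 4 * p.1 * gCurve γ L p.2 := by
  have h1 : 0 < p.1 := hp.1
  have h2 : 0 < p.2 := hp.2
  rw [partialX_ham, ← neg_pos, ← mul_neg, mul_pos_iff_of_pos_left (by positivity), neg_pos, sub_neg]

namespace Heights

variable {zp zc zs : ℝ}

theorem zc_pos (h : Heights γ L zp zc zs) : 0 < zc := h.zp_pos.trans h.zp_lt_zc

theorem zs_pos (h : Heights γ L zp zc zs) : 0 < zs := h.zc_pos.trans h.zc_lt_zs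

theorem critPoly_eq_zero_iff (h : Heights γ L zp zc zs) (hz : 0 < z) :
    critPoly γ L (recipEnthalpy γ z) = 0 ↔ z = zs ∨ z = zc := by
  constructor
  · intro h0
    rcases lt_trichotomy z zc with h1 | h1 | h1
    · exact absurd h0 (h.critPoly_pos_of_lt z hz h1).ne'
    · exact Or.inr h1
    · rcases lt_trichotomy z zs with h2 | h2 | h2
      · exact absurd h0 (h.critPoly_neg z h1 h2).ne
      · exact Or.inl h2
      · exact absurd h0 (h.critPoly_pos_of_gt z h2).ne'
  · rintro (rfl | rfl)
    exacts [h.critPoly_zs, h.critPoly_zc]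

theorem ridgePoint_mul_kCurve (h : Heights γ L zp zc zs) (hz : 0 < z)
    (h0 : critPoly γ L (recipEnthalpy γ z) = 0) :
    (ridgePoint γ L z).1 * kCurve γ L z = 1 := by
  have h1 := four_gCurve_sub_three_kCurve γ L z
  have h2 := h.ridgePoint_spec hz
  rw [h0] at h1
  linear_combination (1 / 3) * h2 - (1 / 3) * (ridgePoint γ L z).1 * h1

theorem criticalPoints_eq (h : Heights γ L zp zc zs) :
    criticalPoints (ham γ L) = {ridgePoint γ L zs, ridgePoint γ L zc} := by
  ext p
  constructor
  · rintro ⟨hp, h1, h2⟩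
    rw [partialX_ham_eq_zero_iff hp] at h1
    rw [partialZ_ham_eq_zero_iff hp] at h2
    have hpx : 0 < p.1 := hp.1
    have h3 : critPoly γ L (recipEnthalpy γ p.2) = 0 := by
      rw [← four_gCurve_sub_three_kCurve]
      refine (mul_eq_zero_iff_left hpx.ne').1 ?_
      linear_combination h1 - 3 * h2
    have hpr := h.eq_ridgePoint hp.2 h1
    rcases (h.critPoly_eq_zero_iff hp.2).1 h3 with h4 | h4 <;> rw [h4] at hpr
    · exact Or.inl hpr
    · exact Or.inr hpr
  · have key : ∀ z > 0, critPoly γ L (recipEnthalpy γ z) = 0 →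
        ridgePoint γ L z ∈ criticalPoints (ham γ L) := by
      intro z hz h0
      have hp : ridgePoint γ L z ∈ phaseSpace := ⟨h.ridgePoint_fst_pos hz, hz⟩
      exact ⟨hp, (partialX_ham_eq_zero_iff hp).2 (h.ridgePoint_spec hz),
        (partialZ_ham_eq_zero_iff hp).2 (h.ridgePoint_mul_kCurve hz h0)⟩
    rintro (rfl | rfl)
    exacts [key _ h.zs_pos h.critPoly_zs, key _ h.zc_pos h.critPoly_zc]

theorem isSaddle (h : Heights γ L zp zc zs) : IsSaddle (ham γ L) (ridgePoint γ L zs) := by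
  refine ⟨h.criticalPoints_eq ▸ Or.inl rfl, ?_⟩
  have h1 := h.ridgePoint_fst_pos h.zs_pos
  have h2 := recipEnthalpy_pos (γ := γ) h.zs_pos
  have h3 := sub_pos.2 (recipEnthalpy_lt_one (γ := γ) h.zs_pos)
  have h4 := sub_pos.2 h.one_lt
  have h5 := h.pos
  have h6 := h.zs_pos
  have := hessianDet_ham_of_critical h.zs_pos h1 (h.ridgePoint_spec h.zs_pos)
    (h.ridgePoint_mul_kCurve h.zs_pos h.critPoly_zs)
  rw [show ridgePoint γ L zs = ((ridgePoint γ L zs).1, zs) from rfl, this]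
  exact mul_neg_of_pos_of_neg (by positivity) (sub_neg.2 h.slope_zs)

theorem isCenter (h : Heights γ L zp zc zs) : IsCenter (ham γ L) (ridgePoint γ L zc) := by
  refine ⟨h.criticalPoints_eq ▸ Or.inr rfl, ?_⟩
  have h1 := h.ridgePoint_fst_pos h.zc_pos
  have h2 := recipEnthalpy_pos (γ := γ) h.zc_pos
  have h3 := sub_pos.2 (recipEnthalpy_lt_one (γ := γ) h.zc_pos)
  have h4 := sub_pos.2 h.one_lt
  have h5 := h.pos
  have h6 := h.zc_pos
  have := hessianDet_ham_of_critical h.zc_pos h1 (h.ridgePoint_spec h.zc_pos)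
    (h.ridgePoint_mul_kCurve h.zc_pos h.critPoly_zc)
  rw [show ridgePoint γ L zc = ((ridgePoint γ L zc).1, zc) from rfl, this]
  exact mul_pos (by positivity) (sub_pos.2 h.slope_zc)

/-! ### The saddle level -/

theorem ridge_zs_pos (h : Heights γ L zp zc zs) : 0 < ridge γ L zs := by
  have := h.gCurve_pos h.zs_pos
  have := h.zs_pos
  unfold ridge
  positivity

theorem ridge_lt_of_lt_zp (h : Heights γ L zp zc zs) (hz : 0 < z) (hzp : z < zp) :
    ridge γ L z < ridge γ L zs := by
  rw [← h.ridge_zp]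
  exact h.ridge_strictMonoOn (convex_Icc z zp) (fun w hw => hz.trans_le hw.1)
    (fun w hw => by
      rw [interior_Icc] at hw
      exact h.critPoly_pos_of_lt w (hz.trans hw.1) (hw.2.trans h.zp_lt_zc))
    ⟨le_rfl, hzp.le⟩ ⟨hzp.le, le_rfl⟩ hzp

theorem lt_ridge_of_mem_Ioc (h : Heights γ L zp zc zs) (h1 : zp < z) (h2 : z ≤ zc) :
    ridge γ L zs < ridge γ L z := by
  rw [← h.ridge_zp]
  exact h.ridge_strictMonoOn (convex_Icc zp z) (fun w hw => h.zp_pos.trans_le hw.1)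
    (fun w hw => by
      rw [interior_Icc] at hw
      exact h.critPoly_pos_of_lt w (h.zp_pos.trans hw.1) (hw.2.trans_le h2))
    ⟨le_rfl, h1.le⟩ ⟨h1.le, le_rfl⟩ h1

theorem lt_ridge_of_mem_Ico (h : Heights γ L zp zc zs) (h1 : zc ≤ z) (h2 : z < zs) :
    ridge γ L zs < ridge γ L z :=
  h.ridge_strictAntiOn (convex_Icc z zs) (fun w hw => h.zc_pos.trans_le (h1.trans hw.1))
    (fun w hw => by
      rw [interior_Icc] at hw
      exact h.critPoly_neg w (h1.trans_lt hw.1) hw.2)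
    ⟨le_rfl, h2.le⟩ ⟨h2.le, le_rfl⟩ h2

theorem lt_ridge_of_zs_lt (h : Heights γ L zp zc zs) (h1 : zs < z) :
    ridge γ L zs < ridge γ L z :=
  h.ridge_strictMonoOn (convex_Icc zs z) (fun w hw => h.zs_pos.trans_le hw.1)
    (fun w hw => by
      rw [interior_Icc] at hw
      exact h.critPoly_pos_of_gt w hw.1)
    ⟨le_rfl, h1.le⟩ ⟨h1.le, le_rfl⟩ h1

theorem eq_of_ridge_eq (h : Heights γ L zp zc zs) (hz : 0 < z) (he : ridge γ L z = ridge γ L zs) :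
    z = zs ∨ z = zp := by
  rcases lt_trichotomy z zp with h1 | h1 | h1
  · exact absurd he (h.ridge_lt_of_lt_zp hz h1).ne
  · exact Or.inr h1
  · rcases le_total z zc with h2 | h2
    · exact absurd he (h.lt_ridge_of_mem_Ioc h1 h2).ne'
    · rcases lt_trichotomy z zs with h3 | h3 | h3
      · exact absurd he (h.lt_ridge_of_mem_Ico h2 h3).ne'
      · exact Or.inl h3
      · exact absurd he (h.lt_ridge_of_zs_lt h3).ne'

end Heights

variable {zp zc zs : ℝ}

/-! ### The Hamiltonian vector field -/

/-- The Hamiltonian vector field in closed form. -/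
def flowField (γ L : ℝ) (p : ℝ × ℝ) : ℝ × ℝ :=
  (2 * p.1 ^ 3 * p.2 * (1 - p.1 * kCurve γ L p.2),
    -(p.1 ^ 2 * p.2 ^ 2 * (3 - 4 * p.1 * gCurve γ L p.2)))

theorem hamField_ham {p : ℝ × ℝ} (hp : p ∈ phaseSpace) :
    hamField (ham γ L) p = flowField γ L p := by
  rw [hamField, partialZ_ham L p.1 hp.2, partialX_ham, flowField]

theorem contDiffOn_flowField (γ L : ℝ) : ContDiffOn ℝ 1 (flowField γ L) phaseSpace := by
  have hy : ContDiffOn ℝ 1 (fun p : ℝ × ℝ => recipEnthalpy γ p.2) phaseSpace :=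
    ((contDiffOn_recipEnthalpy γ).of_le (by norm_num)).comp contDiffOn_snd fun p hp => hp.2
  unfold flowField kCurve gCurve
  fun_prop

theorem flowField_eq_zero_iff {p : ℝ × ℝ} (hp : p ∈ phaseSpace) :
    flowField γ L p = 0 ↔ p ∈ criticalPoints (ham γ L) := by
  rw [← hamField_ham hp, hamField, Prod.mk_eq_zero, neg_eq_zero, criticalPoints]
  exact ⟨fun h => ⟨hp, h.2, h.1⟩, fun h => ⟨h.2.2, h.2.1⟩⟩

theorem continuousAt_ham {p : ℝ × ℝ} (hp : p ∈ phaseSpace) :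
    ContinuousAt (fun q : ℝ × ℝ => ham γ L q.1 q.2) p := by
  simp only [ham_eq]
  have : ContinuousAt (fun q : ℝ × ℝ => gCurve γ L q.2) p :=
    ContinuousAt.comp (f := Prod.snd) (hasDerivAt_gCurve L hp.2).continuousAt continuousAt_snd
  fun_prop

/-- Conservation of energy. -/
theorem ham_eq_of_isSolutionOn {φ : ℝ → ℝ × ℝ} {S : Set ℝ} (hS : Convex ℝ S)
    (hφ : IsSolutionOn (ham γ L) φ S) {t₁ t₂ : ℝ} (h1 : t₁ ∈ S) (h2 : t₂ ∈ S) :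
    ham γ L (φ t₂).1 (φ t₂).2 = ham γ L (φ t₁).1 (φ t₁).2 := by
  have hderiv : ∀ t ∈ S, HasDerivWithinAt (fun t => ham γ L (φ t).1 (φ t).2) 0 S t := by
    intro t ht
    obtain ⟨hp, hd⟩ := hφ t ht
    rw [hamField_ham hp] at hd
    have hdx : HasDerivWithinAt (fun t => (φ t).1) (flowField γ L (φ t)).1 S t :=
      (hasFDerivAt_fst (𝕜 := ℝ) (p := φ t)).comp_hasDerivWithinAt t hd
    have hdz : HasDerivWithinAt (fun t => (φ t).2) (flowField γ L (φ t)).2 S t :=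
      (hasFDerivAt_snd (𝕜 := ℝ) (p := φ t)).comp_hasDerivWithinAt t hd
    have hdg := (hasDerivAt_gCurve (γ := γ) L hp.2).comp_hasDerivWithinAt t hdz
    simp only [ham_eq]
    refine ((hdz.pow 2).mul ((hdx.pow 3).sub ((hdx.pow 4).mul hdg))).congr_deriv ?_
    have hz : (φ t).2 ≠ 0 := (show 0 < (φ t).2 from hp.2).ne'
    simp only [flowField, kCurve, gCurve, Function.comp, Pi.pow_apply, Pi.mul_apply, Pi.sub_apply]
    field_simp
    push_cast
    ring
  have := hS.norm_image_sub_le_of_norm_hasDerivWithin_le (C := 0) hderiv (by simp) h1 h2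
  rw [zero_mul, norm_le_zero_iff, sub_eq_zero] at this
  exact this

/-! ### The loop in the saddle level -/

/-- The part of the saddle level to the right of the saddle. -/
def saddleLoop (γ L zs : ℝ) : Set (ℝ × ℝ) :=
  {p | p ∈ phaseSpace ∧ ham γ L p.1 p.2 = ridge γ L zs ∧ (ridgePoint γ L zs).1 < p.1}

namespace Heights

/-- The vertical line through the saddle meets the saddle level only in the saddle. -/
theorem ham_saddle_line_lt (h : Heights γ L zp zc zs) (hz : 0 < z) (hne : z ≠ zs) :
    ham γ L (ridgePoint γ L zs).1 z < ridge γ L zs := by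
  have hx := h.ridgePoint_fst_pos h.zs_pos
  have hk := h.ridgePoint_mul_kCurve h.zs_pos h.critPoly_zs
  rw [← h.ham_ridgePoint h.zs_pos]
  rcases hne.lt_or_gt with h1 | h1
  · exact h.ham_lt_ham_of_below hx hz h1 hk.le
  · exact h.ham_lt_ham_of_above hx h.zs_pos h1 hk.ge

theorem snd_lt_of_mem_loop (h : Heights γ L zp zc zs) {p : ℝ × ℝ} (hp : p ∈ saddleLoop γ L zs) :
    p.2 < zs := by
  obtain ⟨⟨hx, hz⟩, hH, hs⟩ := hp
  by_contra! hle
  have hg : gCurve γ L zs ≤ gCurve γ L p.2 :=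
    h.gCurve_strictMonoOn.monotoneOn h.zs_pos.le hz.le hle
  have hs0 := h.ridgePoint_fst_pos h.zs_pos
  have h1 : 3 ≤ 4 * (ridgePoint γ L zs).1 * gCurve γ L p.2 := by
    rw [← h.ridgePoint_spec h.zs_pos]
    gcongr
  have h2 := h.ham_lt_ham_of_right hz hs0 hs h1
  rw [hH] at h2
  rcases eq_or_ne p.2 zs with he | he
  · rw [he, h.ham_ridgePoint h.zs_pos] at h2
    exact h2.false
  · exact (h2.trans (h.ham_saddle_line_lt hz he)).false

theorem zp_le_of_ham_eq (h : Heights γ L zp zc zs) (hx : 0 < x) (hz : 0 < z)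
    (hH : ham γ L x z = ridge γ L zs) : zp ≤ z := by
  by_contra! hlt
  have := h.ridge_lt_of_lt_zp hz hlt
  rw [← hH] at this
  exact (this.trans_le (h.ham_le_ridge hz hx)).false

theorem lt_of_ham_eq (h : Heights γ L zp zc zs) (hx : 0 < x) (hz : 0 < z)
    (hH : ham γ L x z = ridge γ L zs) : x < 1 / (1 - L ^ 2) :=
  h.lt_of_ham_pos hz hx (hH ▸ h.ridge_zs_pos)

/-- The saddle level meets the curve `∂H/∂x = 0` exactly at the heights `zs` and `zp`. -/
theorem eq_or_eq_of_level_of_c1 (h : Heights γ L zp zc zs) {p : ℝ × ℝ} (hp : p ∈ phaseSpace)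
    (hH : ham γ L p.1 p.2 = ridge γ L zs) (h1 : 4 * p.1 * gCurve γ L p.2 = 3) :
    p = ridgePoint γ L zs ∨ p = ridgePoint γ L zp := by
  have h2 := h.eq_ridgePoint hp.2 h1
  rw [h.ham_eq_ridge hp.2 h1] at hH
  rcases h.eq_of_ridge_eq hp.2 hH with h3 | h3 <;> rw [h3] at h2
  exacts [Or.inl h2, Or.inr h2]

theorem ridgePoint_zp_mem_loop (h : Heights γ L zp zc zs) :
    ridgePoint γ L zp ∈ saddleLoop γ L zs :=
  ⟨⟨h.ridgePoint_fst_pos h.zp_pos, h.zp_pos⟩, by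
    rw [← h.ridge_zp]; exact h.ham_ridgePoint h.zp_pos,
    h.ridgePoint_fst_lt h.zp_pos (h.zp_lt_zc.trans h.zc_lt_zs)⟩

theorem eq_zp_of_mem_loop (h : Heights γ L zp zc zs) {p : ℝ × ℝ} (hp : p ∈ saddleLoop γ L zs)
    (h1 : 4 * p.1 * gCurve γ L p.2 = 3) : p = ridgePoint γ L zp := by
  rcases h.eq_or_eq_of_level_of_c1 hp.1 hp.2.1 h1 with h2 | h2
  · exact absurd (h2 ▸ hp.2.2) (lt_irrefl _)
  · exact h2

/-- On the loop, the curve `∂H/∂z = 0` is met only where `∂H/∂x < 0`: between the two critical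
points it runs strictly above the saddle level. -/
theorem c1_lt_of_mem_loop_of_c2 (h : Heights γ L zp zc zs) {p : ℝ × ℝ}
    (hp : p ∈ saddleLoop γ L zs) (h2 : p.1 * kCurve γ L p.2 = 1) :
    3 < 4 * p.1 * gCurve γ L p.2 := by
  have hzs := h.snd_lt_of_mem_loop hp
  obtain ⟨⟨hx, hz⟩, hH, hs⟩ := hp
  have hgk := four_gCurve_sub_three_kCurve γ L p.2
  have hdiff : 4 * p.1 * gCurve γ L p.2 - 3 =
      p.1 * critPoly γ L (recipEnthalpy γ p.2) := by
    rw [← hgk]; linear_combination 3 * h2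
  rcases lt_trichotomy p.2 zc with h1 | h1 | h1
  · have := mul_pos hx (h.critPoly_pos_of_lt p.2 hz h1)
    linarith
  · have h3 : 4 * p.1 * gCurve γ L p.2 = 3 := by
      rw [h1, h.critPoly_zc, mul_zero] at hdiff
      rw [h1]; linarith
    have h4 := h.lt_ridge_of_mem_Ico h1.ge hzs
    rw [← h.ham_eq_ridge hz h3, hH] at h4
    exact absurd h4 (lt_irrefl _)
  · exfalso
    have hneg := mul_neg_of_pos_of_neg hx (h.critPoly_neg p.2 h1 hzs)
    -- the height above `p` at which the vertical line through `p` meets `∂H/∂x = 0`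
    have hcont : ContinuousOn (gCurve γ L) (Icc p.2 zs) :=
      h.continuousOn_gCurve.mono fun w hw => hz.le.trans hw.1
    have hmem : 3 / (4 * p.1) ∈ Icc (gCurve γ L p.2) (gCurve γ L zs) := by
      constructor
      · rw [le_div_iff₀ (by positivity)]; linarith
      · rw [div_le_iff₀ (by positivity), ← h.ridgePoint_spec h.zs_pos]
        have := h.gCurve_pos h.zs_pos
        nlinarith [mul_lt_mul_of_pos_right hs this]
    obtain ⟨w, hw, hgw⟩ := intermediate_value_Icc hzs.le hcont hmem
    have hw3 : 4 * p.1 * gCurve γ L w = 3 := by rw [hgw]; field_simp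
    have hpw : p.2 < w := hw.1.lt_of_ne (by rintro he; rw [← he] at hw3; linarith)
    have hws : w < zs := hw.2.lt_of_ne (by
      rintro rfl
      have h5 := h.ridgePoint_spec h.zs_pos
      have h6 := h.gCurve_pos h.zs_pos
      nlinarith [mul_lt_mul_of_pos_right hs h6])
    have h7 := h.ham_lt_ham_of_above hx hz hpw h2.ge
    rw [h.ham_eq_ridge (hz.trans hpw) hw3, hH] at h7
    exact (h7.trans (h.lt_ridge_of_mem_Ico (h1.trans hpw).le hws)).false

/-- The loop together with the saddle, described by weak inequalities, is closed
(`mem_loop_or_eq_saddle` identifies its points). -/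
theorem isClosed_loop_closure (h : Heights γ L zp zc zs) :
    IsClosed {p : ℝ × ℝ | p ∈ Ici (ridgePoint γ L zs).1 ×ˢ Icc zp zs ∧
      ham γ L p.1 p.2 = ridge γ L zs} := by
  have hs := h.ridgePoint_fst_pos h.zs_pos
  exact ContinuousOn.preimage_isClosed_of_isClosed (t := {ridge γ L zs})
    (fun p hp => (continuousAt_ham (γ := γ) (L := L)
      ⟨hs.trans_le hp.1, h.zp_pos.trans_le hp.2.1⟩).continuousWithinAt)
    (isClosed_Ici.prod isClosed_Icc) isClosed_singleton

theorem loop_subset_closure (h : Heights γ L zp zc zs) {p : ℝ × ℝ} (hp : p ∈ saddleLoop γ L zs) :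
    p ∈ Ici (ridgePoint γ L zs).1 ×ˢ Icc zp zs ∧ ham γ L p.1 p.2 = ridge γ L zs :=
  ⟨⟨hp.2.2.le, h.zp_le_of_ham_eq hp.1.1 hp.1.2 hp.2.1, (h.snd_lt_of_mem_loop hp).le⟩, hp.2.1⟩

theorem mem_loop_or_eq_saddle (h : Heights γ L zp zc zs) {p : ℝ × ℝ}
    (hp : p ∈ Ici (ridgePoint γ L zs).1 ×ˢ Icc zp zs) (hH : ham γ L p.1 p.2 = ridge γ L zs) :
    p ∈ saddleLoop γ L zs ∨ p = ridgePoint γ L zs := by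
  have hz : 0 < p.2 := h.zp_pos.trans_le hp.2.1
  rcases (mem_Ici.1 hp.1).lt_or_eq with h1 | h1
  · exact Or.inl ⟨⟨(h.ridgePoint_fst_pos h.zs_pos).trans h1, hz⟩, hH, h1⟩
  · refine Or.inr (Prod.ext h1.symm ?_)
    by_contra hne
    have := h.ham_saddle_line_lt hz hne
    rw [h1, hH] at this
    exact this.false

/-- The solution through the ridge point of height `zp` exists for all times and stays on the
loop. It cannot leave the loop, since the only further point of the closure is an equilibrium. -/
theorem exists_loop_solution (h : Heights γ L zp zc zs) : ∃ φ : ℝ → ℝ × ℝ,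
    φ 0 = ridgePoint γ L zp ∧
    ∀ t, φ t ∈ saddleLoop γ L zs ∧ HasDerivAt φ (flowField γ L (φ t)) t := by
  set s := ridgePoint γ L zs with hs
  have hs0 : 0 < s.1 := h.ridgePoint_fst_pos h.zs_pos
  have hsb : s.1 < 1 / (1 - L ^ 2) :=
    h.lt_of_ham_eq hs0 h.zs_pos (h.ham_ridgePoint h.zs_pos)
  have hps := h.zp_lt_zc.trans h.zc_lt_zs
  have hzp := h.zp_pos
  set a := s.1 / 2
  set b := 1 / (1 - L ^ 2)
  set c := zp / 2 with hc
  set d := zs + 1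
  have hbox : Icc a b ×ˢ Icc c d ⊆ phaseSpace := fun p hp =>
    ⟨(half_pos hs0).trans_le hp.1.1, (half_pos hzp).trans_le hp.2.1⟩
  obtain ⟨v, K, C, hv, hC, hvV⟩ := exists_lipschitz_extension_of_box (a := a) (b := b)
    (c := c) (d := d) (by simp only [a, b]; linarith) (by simp only [c, d]; linarith)
    ((contDiffOn_flowField γ L).mono hbox)
  obtain ⟨φ, hφ0, hφ⟩ := exists_global_integralCurve hv hC (ridgePoint γ L zp)
  have hcont : Continuous φ := continuous_iff_continuousAt.2 fun t => (hφ t).continuousAt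
  have hsbox : s ∈ Icc a b ×ˢ Icc c d :=
    ⟨⟨by simp only [a]; linarith, hsb.le⟩, by
      change zp / 2 ≤ zs; linarith, by change zs ≤ zs + 1; linarith⟩
  have hvs : v s = 0 := by
    rw [hvV hsbox, flowField_eq_zero_iff (hbox hsbox), h.criticalPoints_eq]
    exact Or.inl rfl
  have hne : ∀ t, φ t ≠ s := by
    intro t ht
    have heq : φ = fun _ => s := ODE_solution_unique_univ (v := fun _ => v) (s := fun _ => univ)
      (t₀ := t) (fun _ => hv.lipschitzOnWith) (fun r => ⟨hφ r, mem_univ _⟩)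
      (fun r => ⟨by rw [hvs]; exact hasDerivAt_const r s, mem_univ _⟩) ht
    have h0 : ridgePoint γ L zp = s := by rw [← hφ0, heq]
    have := congrArg Prod.snd h0
    exact hps.ne this
  let U : Set (ℝ × ℝ) := Ioo s.1 b ×ˢ Ioo c d
  have hU : IsOpen U := isOpen_Ioo.prod isOpen_Ioo
  have hUbox : U ⊆ Icc a b ×ˢ Icc c d := fun p hp =>
    ⟨⟨by simp only [a]; linarith [hp.1.1], hp.1.2.le⟩, hp.2.1.le, hp.2.2.le⟩
  have hloopU : saddleLoop γ L zs ⊆ U := fun p hp =>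
    ⟨⟨hp.2.2, h.lt_of_ham_eq hp.1.1 hp.1.2 hp.2.1⟩, by
      linarith [h.zp_le_of_ham_eq hp.1.1 hp.1.2 hp.2.1], by
      linarith [h.snd_lt_of_mem_loop hp]⟩
  have hclopen : IsClopen {t | φ t ∈ saddleLoop γ L zs} := by
    constructor
    · refine isClosed_of_closure_subset fun t ht => ?_
      have h1 := (h.isClosed_loop_closure.preimage hcont).closure_subset_iff.2
        (fun r (hr : φ r ∈ saddleLoop γ L zs) => h.loop_subset_closure hr) ht
      exact (h.mem_loop_or_eq_saddle h1.1 h1.2).resolve_right (hne t)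
    · rw [isOpen_iff_mem_nhds]
      intro t (ht : φ t ∈ saddleLoop γ L zs)
      obtain ⟨ε, hε, hball⟩ := Metric.isOpen_iff.1 (hU.preimage hcont) t (hloopU ht)
      refine Filter.mem_of_superset (Metric.ball_mem_nhds t hε) fun r hr => ?_
      have hsol : IsSolutionOn (ham γ L) φ (Metric.ball t ε) := fun q hq => by
        have hq' := hUbox (hball hq)
        refine ⟨hbox hq', ?_⟩
        rw [hamField_ham (hbox hq'), ← hvV hq']
        exact (hφ q).hasDerivWithinAt
      refine ⟨hbox (hUbox (hball hr)), ?_, (hball hr).1.1⟩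
      rw [ham_eq_of_isSolutionOn (convex_ball t ε) hsol (Metric.mem_ball_self hε) hr]
      exact ht.2.1
  have huniv := hclopen.eq_univ ⟨0, by rw [mem_ofPred, hφ0]; exact h.ridgePoint_zp_mem_loop⟩
  have hall : ∀ t, φ t ∈ saddleLoop γ L zs := fun t => by
    have : t ∈ {t | φ t ∈ saddleLoop γ L zs} := huniv ▸ mem_univ t
    exact this
  refine ⟨φ, hφ0, fun t => ⟨hall t, ?_⟩⟩
  rw [← hvV (hUbox (hloopU (hall t)))]
  exact hφ t

end Heights

variable {φ : ℝ → ℝ × ℝ}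

/-! ### Dynamics on the loop -/

/-- A global solution on the loop, started at the ridge point of height `zp`. -/
structure LoopSolution (γ L zp zs : ℝ) (φ : ℝ → ℝ × ℝ) : Prop where
  init : φ 0 = ridgePoint γ L zp
  mem : ∀ t, φ t ∈ saddleLoop γ L zs
  deriv : ∀ t, HasDerivAt φ (flowField γ L (φ t)) t

namespace LoopSolution

theorem hasDerivAt_fst (hφ : LoopSolution γ L zp zs φ) (t : ℝ) :
    HasDerivAt (fun t => (φ t).1)
      (2 * (φ t).1 ^ 3 * (φ t).2 * (1 - (φ t).1 * kCurve γ L (φ t).2)) t :=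
  (hasFDerivAt_fst (𝕜 := ℝ) (p := φ t)).comp_hasDerivAt t (hφ.deriv t)

theorem hasDerivAt_snd (hφ : LoopSolution γ L zp zs φ) (t : ℝ) :
    HasDerivAt (fun t => (φ t).2)
      (-((φ t).1 ^ 2 * (φ t).2 ^ 2 * (3 - 4 * (φ t).1 * gCurve γ L (φ t).2))) t :=
  (hasFDerivAt_snd (𝕜 := ℝ) (p := φ t)).comp_hasDerivAt t (hφ.deriv t)

theorem fst_pos (hφ : LoopSolution γ L zp zs φ) (t : ℝ) : 0 < (φ t).1 := (hφ.mem t).1.1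

theorem snd_pos (hφ : LoopSolution γ L zp zs φ) (t : ℝ) : 0 < (φ t).2 := (hφ.mem t).1.2

theorem continuous (hφ : LoopSolution γ L zp zs φ) : Continuous φ :=
  continuous_iff_continuousAt.2 fun t => (hφ.deriv t).continuousAt

theorem isSolutionOn (hφ : LoopSolution γ L zp zs φ) (S : Set ℝ) :
    IsSolutionOn (ham γ L) φ S := fun t _ =>
  ⟨(hφ.mem t).1, by rw [hamField_ham (hφ.mem t).1]; exact (hφ.deriv t).hasDerivWithinAt⟩

/-- The solution crosses `∂H/∂x = 0` only from the side `∂H/∂x > 0` to the side `∂H/∂x < 0`: at a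
crossing, which can only happen at height `zp`, `z` is stationary and `x` increases. -/
theorem deriv_c1_pos (hφ : LoopSolution γ L zp zs φ) (h : Heights γ L zp zc zs) :
    ∃ D' : ℝ → ℝ, (∀ t, HasDerivAt (fun t => 4 * (φ t).1 * gCurve γ L (φ t).2 - 3) (D' t) t) ∧
      ∀ t, 4 * (φ t).1 * gCurve γ L (φ t).2 - 3 = 0 → 0 < D' t := by
  have hcomp := fun t => HasDerivAt.comp (h₂ := gCurve γ L) (h := fun t => (φ t).2) t
    (hasDerivAt_gCurve L (hφ.snd_pos t)) (hφ.hasDerivAt_snd t)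
  refine ⟨_, fun t => (((hφ.hasDerivAt_fst t).const_mul 4).mul (hcomp t)).sub_const 3,
    fun t ht => ?_⟩
  have h3 : 4 * (φ t).1 * gCurve γ L (φ t).2 = 3 := by linarith
  have hzp : (φ t).2 = zp := congrArg Prod.snd (h.eq_zp_of_mem_loop (hφ.mem t) h3)
  have hx := hφ.fst_pos t
  have hz := hφ.snd_pos t
  have hg := h.gCurve_pos hz
  have hq := mul_pos hx (h.critPoly_pos_of_lt _ hz (hzp.trans_lt h.zp_lt_zc))
  have hgk := four_gCurve_sub_three_kCurve γ L (φ t).2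
  have hk : 0 < 1 - (φ t).1 * kCurve γ L (φ t).2 := by
    rw [← hgk] at hq
    linarith
  have h0 : 3 - 4 * (φ t).1 * gCurve γ L (φ t).2 = 0 := by linarith
  simp only [Function.comp]
  rw [h0, mul_zero, neg_zero, mul_zero, mul_zero, add_zero]
  positivity

theorem c1_at_zero (hφ : LoopSolution γ L zp zs φ) (h : Heights γ L zp zc zs) :
    4 * (φ 0).1 * gCurve γ L (φ 0).2 = 3 := by
  rw [hφ.init]
  exact h.ridgePoint_spec h.zp_pos

theorem c1_of_pos (hφ : LoopSolution γ L zp zs φ) (h : Heights γ L zp zc zs) {t : ℝ}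
    (ht : 0 < t) : 3 < 4 * (φ t).1 * gCurve γ L (φ t).2 := by
  obtain ⟨D', hD, hD0⟩ := hφ.deriv_c1_pos h
  have := pos_of_deriv_pos_at_zeros (a := 0) hD (fun t _ => hD0 t)
    (by simp only [hφ.c1_at_zero h]; norm_num) t ht
  linarith

theorem c1_of_neg (hφ : LoopSolution γ L zp zs φ) (h : Heights γ L zp zc zs) {t : ℝ}
    (ht : t < 0) : 4 * (φ t).1 * gCurve γ L (φ t).2 < 3 := by
  obtain ⟨D', hD, hD0⟩ := hφ.deriv_c1_pos h
  have := neg_of_deriv_pos_at_zeros (a := 0) hD (fun t _ => hD0 t)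
    (by simp only [hφ.c1_at_zero h]; norm_num) t ht
  linarith

theorem snd_strictMonoOn (hφ : LoopSolution γ L zp zs φ) (h : Heights γ L zp zc zs) :
    StrictMonoOn (fun t => (φ t).2) (Ici 0) := by
  refine strictMonoOn_of_hasDerivWithinAt_pos (convex_Ici 0)
    (continuous_snd.comp hφ.continuous).continuousOn
    (fun t _ => (hφ.hasDerivAt_snd t).hasDerivWithinAt) fun t ht => ?_
  rw [interior_Ici] at ht
  have hx := hφ.fst_pos t
  have hz := hφ.snd_pos t
  have h1 := hφ.c1_of_pos h ht
  exact neg_pos.2 (mul_neg_of_pos_of_neg (by positivity) (by linarith))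

theorem snd_strictAntiOn (hφ : LoopSolution γ L zp zs φ) (h : Heights γ L zp zc zs) :
    StrictAntiOn (fun t => (φ t).2) (Iic 0) := by
  refine strictAntiOn_of_hasDerivWithinAt_neg (convex_Iic 0)
    (continuous_snd.comp hφ.continuous).continuousOn
    (fun t _ => (hφ.hasDerivAt_snd t).hasDerivWithinAt) fun t ht => ?_
  rw [interior_Iic] at ht
  have hx := hφ.fst_pos t
  have hz := hφ.snd_pos t
  have h1 := hφ.c1_of_neg h ht
  exact neg_neg_of_pos (mul_pos (by positivity) (by linarith))

/-- A curve on the loop that moves with the flow, forwards or backwards, can only converge to the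
saddle: the limit is an equilibrium of the right energy. -/
theorem _root_.Michel.Heights.limit_eq_saddle (h : Heights γ L zp zc zs) {ψ : ℝ → ℝ × ℝ} {ε : ℝ}
    (hε : ε ≠ 0) (hmem : ∀ t, ψ t ∈ saddleLoop γ L zs)
    (hψ : ∀ t, HasDerivAt ψ (ε • flowField γ L (ψ t)) t) {q : ℝ × ℝ}
    (hq : Tendsto ψ atTop (𝓝 q)) : q = ridgePoint γ L zs := by
  have hcl := h.isClosed_loop_closure.mem_of_tendsto hq
    (Eventually.of_forall fun t => h.loop_subset_closure (hmem t))
  have hqp : q ∈ phaseSpace :=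
    ⟨(h.ridgePoint_fst_pos h.zs_pos).trans_le hcl.1.1, h.zp_pos.trans_le hcl.1.2.1⟩
  have hphase : IsOpen phaseSpace :=
    (isOpen_lt continuous_const continuous_fst).inter (isOpen_lt continuous_const continuous_snd)
  have hlim : Tendsto (fun t => ε • flowField γ L (ψ t)) atTop (𝓝 (ε • flowField γ L q)) :=
    ((((contDiffOn_flowField γ L).continuousOn.continuousAt
      (hphase.mem_nhds hqp)).tendsto).comp hq).const_smul ε
  have h1 : (ε • flowField γ L q).1 = 0 := eq_zero_of_tendsto_deriv_atTop
    (fun t => (_root_.hasFDerivAt_fst (𝕜 := ℝ) (p := ψ t)).comp_hasDerivAt t (hψ t))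
    ((continuous_fst.tendsto _).comp hq) ((continuous_fst.tendsto _).comp hlim)
  have h2 : (ε • flowField γ L q).2 = 0 := eq_zero_of_tendsto_deriv_atTop
    (fun t => (_root_.hasFDerivAt_snd (𝕜 := ℝ) (p := ψ t)).comp_hasDerivAt t (hψ t))
    ((continuous_snd.tendsto _).comp hq) ((continuous_snd.tendsto _).comp hlim)
  have h3 : flowField γ L q = 0 := (smul_eq_zero_iff_right hε).1 (Prod.ext h1 h2)
  rw [flowField_eq_zero_iff hqp, h.criticalPoints_eq] at h3
  rcases h3 with h3 | h3
  · exact h3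
  · rw [mem_singleton_iff] at h3
    have h4 := hcl.2
    rw [h3] at h4
    exact absurd ((h.ham_ridgePoint h.zc_pos).symm.trans h4)
      (h.lt_ridge_of_mem_Ico le_rfl h.zc_lt_zs).ne'

theorem limit_atTop_eq_saddle (hφ : LoopSolution γ L zp zs φ) (h : Heights γ L zp zc zs)
    {q : ℝ × ℝ} (hq : Tendsto φ atTop (𝓝 q)) : q = ridgePoint γ L zs :=
  h.limit_eq_saddle one_ne_zero hφ.mem (fun t => by simpa using hφ.deriv t) hq

theorem fst_strictMonoOn (hφ : LoopSolution γ L zp zs φ) {S : Set ℝ} (hS : Convex ℝ S)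
    (hk : ∀ t ∈ interior S, (φ t).1 * kCurve γ L (φ t).2 < 1) :
    StrictMonoOn (fun t => (φ t).1) S := by
  refine strictMonoOn_of_hasDerivWithinAt_pos hS
    (continuous_fst.comp hφ.continuous).continuousOn
    (fun t _ => (hφ.hasDerivAt_fst t).hasDerivWithinAt) fun t ht => ?_
  have hx := hφ.fst_pos t
  have hz := hφ.snd_pos t
  exact mul_pos (by positivity) (sub_pos.2 (hk t ht))

theorem fst_strictAntiOn (hφ : LoopSolution γ L zp zs φ) {S : Set ℝ} (hS : Convex ℝ S)
    (hk : ∀ t ∈ interior S, 1 < (φ t).1 * kCurve γ L (φ t).2) :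
    StrictAntiOn (fun t => (φ t).1) S := by
  refine strictAntiOn_of_hasDerivWithinAt_neg hS
    (continuous_fst.comp hφ.continuous).continuousOn
    (fun t _ => (hφ.hasDerivAt_fst t).hasDerivWithinAt) fun t ht => ?_
  have hx := hφ.fst_pos t
  have hz := hφ.snd_pos t
  exact mul_neg_of_pos_of_neg (by positivity) (sub_neg.2 (hk t ht))

/-- `x` has a single turning point along the loop: it increases up to a time `T` and decreases
afterwards. Crossings of `∂H/∂z = 0` go in one direction only, because `z` increases there; and
there is a crossing, because otherwise `x` would increase to a limit beyond the saddle. -/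
theorem exists_turning_time (hφ : LoopSolution γ L zp zs φ) (h : Heights γ L zp zc zs) :
    ∃ T > 0, (φ T).1 * kCurve γ L (φ T).2 = 1 ∧
      (∀ t < T, (φ t).1 * kCurve γ L (φ t).2 < 1) ∧
      ∀ t > T, 1 < (φ t).1 * kCurve γ L (φ t).2 := by
  obtain ⟨F', hF, hF0⟩ : ∃ F' : ℝ → ℝ,
      (∀ t, HasDerivAt (fun t => (φ t).1 * kCurve γ L (φ t).2 - 1) (F' t) t) ∧
      ∀ t, (φ t).1 * kCurve γ L (φ t).2 - 1 = 0 → 0 < F' t := by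
    have hcomp := fun t => HasDerivAt.comp (h₂ := kCurve γ L) (h := fun t => (φ t).2) t
      (hasDerivAt_kCurve L (hφ.snd_pos t)) (hφ.hasDerivAt_snd t)
    refine ⟨_, fun t => ((hφ.hasDerivAt_fst t).mul (hcomp t)).sub_const 1, fun t ht => ?_⟩
    have hx := hφ.fst_pos t
    have hz := hφ.snd_pos t
    have hy := recipEnthalpy_pos (γ := γ) hz
    have hy1 := sub_pos.2 (recipEnthalpy_lt_one (γ := γ) hz)
    have hL := h.pos
    have hγ := sub_pos.2 h.one_lt
    have hγ2 := sub_nonneg.2 h.gamma_le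
    have h1 := h.c1_lt_of_mem_loop_of_c2 (hφ.mem t) (sub_eq_zero.1 ht)
    have h2 : 0 < -((φ t).1 ^ 2 * (φ t).2 ^ 2 * (3 - 4 * (φ t).1 * gCurve γ L (φ t).2)) :=
      neg_pos.2 (mul_neg_of_pos_of_neg (by positivity) (by linarith))
    have h0 : 1 - (φ t).1 * kCurve γ L (φ t).2 = 0 := by linarith
    simp only [Function.comp]
    rw [h0, mul_zero, zero_mul, zero_add]
    exact mul_pos hx (mul_pos (by positivity) h2)
  have hcont : Continuous fun t => (φ t).1 * kCurve γ L (φ t).2 - 1 :=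
    continuous_iff_continuousAt.2 fun t => (hF t).continuousAt
  have hzero : (φ 0).1 * kCurve γ L (φ 0).2 - 1 < 0 := by
    have h1 := hφ.c1_at_zero h
    have h2 := four_gCurve_sub_three_kCurve γ L (φ 0).2
    have h3 : (φ 0).2 < zc := by rw [hφ.init]; exact h.zp_lt_zc
    have h4 := mul_pos (hφ.fst_pos 0) (h.critPoly_pos_of_lt _ (hφ.snd_pos 0) h3)
    rw [← h2] at h4
    linarith
  have hex : ∃ t > 0, 0 ≤ (φ t).1 * kCurve γ L (φ t).2 - 1 := by
    by_contra! hcon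
    have hmono : StrictMonoOn (fun t => (φ t).1) (Ici 0) :=
      hφ.fst_strictMonoOn (convex_Ici 0) fun t ht => by
        rw [interior_Ici] at ht
        linarith [hcon t ht]
    obtain ⟨l, hl⟩ := exists_tendsto_of_monotoneOn hmono.monotoneOn (B := 1 / (1 - L ^ 2))
      fun t _ => (h.lt_of_ham_eq (hφ.fst_pos t) (hφ.snd_pos t) (hφ.mem t).2.1).le
    obtain ⟨m, hm⟩ := exists_tendsto_of_monotoneOn (hφ.snd_strictMonoOn h).monotoneOn (B := zs)
      fun t _ => (h.snd_lt_of_mem_loop (hφ.mem t)).le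
    have hlm := hφ.limit_atTop_eq_saddle h (hl.prodMk_nhds hm)
    have h0l : (φ 0).1 ≤ l := ge_of_tendsto hl <| by
      filter_upwards [eventually_ge_atTop 0] with t ht
        using hmono.monotoneOn self_mem_Ici ht ht
    have h1 : l = (ridgePoint γ L zs).1 := congrArg Prod.fst hlm
    linarith [(hφ.mem 0).2.2]
  obtain ⟨t₁, ht₁, h1⟩ := hex
  obtain ⟨T, hT, hT0⟩ := intermediate_value_Icc ht₁.le hcont.continuousOn
    (show (0 : ℝ) ∈ Icc _ _ from ⟨hzero.le, h1⟩)
  refine ⟨T, hT.1.lt_of_ne ?_, by linarith, fun t ht => ?_, fun t ht => ?_⟩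
  · rintro rfl
    exact hzero.ne hT0
  · have := neg_of_deriv_pos_at_zeros (a := T) hF (fun t _ => hF0 t) hT0.le t ht
    linarith
  · have := pos_of_deriv_pos_at_zeros (a := T) hF (fun t _ => hF0 t) hT0.ge t ht
    linarith

theorem tendsto_atTop (hφ : LoopSolution γ L zp zs φ) (h : Heights γ L zp zc zs) :
    Tendsto φ atTop (𝓝 (ridgePoint γ L zs)) := by
  obtain ⟨T, -, -, -, hT⟩ := hφ.exists_turning_time h
  have hanti : StrictAntiOn (fun t => (φ t).1) (Ici T) :=
    hφ.fst_strictAntiOn (convex_Ici T) fun t ht => hT t (by rwa [interior_Ici] at ht)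
  obtain ⟨l, hl⟩ := exists_tendsto_of_antitoneOn hanti.antitoneOn (B := 0)
    fun t _ => (hφ.fst_pos t).le
  obtain ⟨m, hm⟩ := exists_tendsto_of_monotoneOn (hφ.snd_strictMonoOn h).monotoneOn (B := zs)
    fun t _ => (h.snd_lt_of_mem_loop (hφ.mem t)).le
  exact hφ.limit_atTop_eq_saddle h (hl.prodMk_nhds hm) ▸ hl.prodMk_nhds hm

theorem tendsto_atBot (hφ : LoopSolution γ L zp zs φ) (h : Heights γ L zp zc zs) :
    Tendsto φ atBot (𝓝 (ridgePoint γ L zs)) := by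
  obtain ⟨T, hT0, -, hT, -⟩ := hφ.exists_turning_time h
  have hmono : StrictMonoOn (fun t => (φ t).1) (Iic 0) :=
    hφ.fst_strictMonoOn (convex_Iic 0) fun t ht => hT t (by
      rw [interior_Iic] at ht
      exact lt_trans ht hT0)
  obtain ⟨l, hl⟩ := exists_tendsto_of_antitoneOn (f := fun t => (φ (-t)).1) (a := 0) (B := 0)
    (fun s hs t ht hst => hmono.monotoneOn (mem_Iic.2 (neg_nonpos.2 ht))
      (mem_Iic.2 (neg_nonpos.2 hs)) (neg_le_neg hst)) fun t _ => (hφ.fst_pos _).le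
  obtain ⟨m, hm⟩ := exists_tendsto_of_monotoneOn (f := fun t => (φ (-t)).2) (a := 0) (B := zs)
    (fun s hs t ht hst => (hφ.snd_strictAntiOn h).antitoneOn (mem_Iic.2 (neg_nonpos.2 ht))
      (mem_Iic.2 (neg_nonpos.2 hs)) (neg_le_neg hst))
    fun t _ => (h.snd_lt_of_mem_loop (hφ.mem _)).le
  have hlim : Tendsto (fun t => φ (-t)) atTop (𝓝 (l, m)) := hl.prodMk_nhds hm
  have heq := h.limit_eq_saddle (ε := -1) (by norm_num) (fun t => hφ.mem (-t))
    (fun t => (hφ.deriv (-t)).scomp t (hasDerivAt_neg t)) hlim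
  rw [heq] at hlim
  simpa [Function.comp_def] using hlim.comp tendsto_neg_atBot_atTop

/-- Every point of the loop is reached: each height is attained on both sides of the curve
`∂H/∂x = 0`, and height and side determine a point of the loop. -/
theorem range_eq_loop (hφ : LoopSolution γ L zp zs φ) (h : Heights γ L zp zc zs) :
    range φ = saddleLoop γ L zs := by
  refine Subset.antisymm (by rintro _ ⟨t, rfl⟩; exact hφ.mem t) fun p hp => ?_
  have hcont : Continuous fun t => (φ t).2 := continuous_snd.comp hφ.continuous
  have hps := h.snd_lt_of_mem_loop hp
  have hzp := h.zp_le_of_ham_eq hp.1.1 hp.1.2 hp.2.1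
  have h0 : (φ 0).2 = zp := by rw [hφ.init]; rfl
  rcases lt_trichotomy (4 * p.1 * gCurve γ L p.2) 3 with h1 | h1 | h1
  · have hev : ∀ᶠ t in atBot, p.2 < (φ t).2 :=
      ((continuous_snd.tendsto _).comp (hφ.tendsto_atBot h)).eventually (eventually_gt_nhds hps)
    obtain ⟨t₁, h2, h3⟩ := (hev.and (eventually_le_atBot 0)).exists
    obtain ⟨t, ht, hte⟩ := intermediate_value_Icc' h3 hcont.continuousOn
      (show p.2 ∈ Icc _ _ from ⟨h0.trans_le hzp, h2.le⟩)
    have h4 : 4 * (φ t).1 * gCurve γ L (φ t).2 ≤ 3 := by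
      rcases ht.2.lt_or_eq with h5 | h5
      · exact (hφ.c1_of_neg h h5).le
      · rw [h5]; exact (hφ.c1_at_zero h).le
    refine ⟨t, Prod.ext ?_ hte⟩
    simp only at hte
    rw [hte] at h4
    have hH := (hφ.mem t).2.1
    rw [hte] at hH
    rcases lt_trichotomy (φ t).1 p.1 with h5 | h5 | h5
    · exact absurd (hH.trans hp.2.1.symm) (h.ham_lt_ham_of_left hp.1.2 (hφ.fst_pos t) h5 h1.le).ne
    · exact h5
    · exact absurd (hH.trans hp.2.1.symm) (h.ham_lt_ham_of_left hp.1.2 hp.1.1 h5 h4).ne'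
  · exact ⟨0, by rw [hφ.init, h.eq_zp_of_mem_loop hp h1]⟩
  · have hev : ∀ᶠ t in atTop, p.2 < (φ t).2 :=
      ((continuous_snd.tendsto _).comp (hφ.tendsto_atTop h)).eventually (eventually_gt_nhds hps)
    obtain ⟨t₁, h2, h3⟩ := (hev.and (eventually_ge_atTop 0)).exists
    obtain ⟨t, ht, hte⟩ := intermediate_value_Icc h3 hcont.continuousOn
      (show p.2 ∈ Icc _ _ from ⟨h0.trans_le hzp, h2.le⟩)
    have h4 : 3 ≤ 4 * (φ t).1 * gCurve γ L (φ t).2 := by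
      rcases ht.1.lt_or_eq with h5 | h5
      · exact (hφ.c1_of_pos h h5).le
      · rw [← h5]; exact (hφ.c1_at_zero h).ge
    refine ⟨t, Prod.ext ?_ hte⟩
    simp only at hte
    rw [hte] at h4
    have hH := (hφ.mem t).2.1
    rw [hte] at hH
    rcases lt_trichotomy (φ t).1 p.1 with h5 | h5 | h5
    · exact absurd (hH.trans hp.2.1.symm)
        (h.ham_lt_ham_of_right hp.1.2 (hφ.fst_pos t) h5 h4).ne'
    · exact h5
    · exact absurd (hH.trans hp.2.1.symm)
        (h.ham_lt_ham_of_right hp.1.2 hp.1.1 h5 h1.le).ne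

end LoopSolution

/-! ### The invariant manifolds of the saddle -/

theorem isSolutionOn_saddle (h : Heights γ L zp zc zs) (S : Set ℝ) :
    IsSolutionOn (ham γ L) (fun _ => ridgePoint γ L zs) S := by
  intro t _
  have hp : ridgePoint γ L zs ∈ phaseSpace := ⟨h.ridgePoint_fst_pos h.zs_pos, h.zs_pos⟩
  refine ⟨hp, ?_⟩
  rw [hamField_ham hp, (flowField_eq_zero_iff hp).2 (h.criticalPoints_eq ▸ Or.inl rfl)]
  exact hasDerivWithinAt_const _ _ _

namespace Heights

theorem continuousAt_saddle (h : Heights γ L zp zc zs) :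
    Tendsto (fun q : ℝ × ℝ => ham γ L q.1 q.2) (𝓝 (ridgePoint γ L zs)) (𝓝 (ridge γ L zs)) := by
  have := (continuousAt_ham (γ := γ) (L := L) (p := ridgePoint γ L zs)
    ⟨h.ridgePoint_fst_pos h.zs_pos, h.zs_pos⟩).tendsto
  rwa [show ham γ L (ridgePoint γ L zs).1 (ridgePoint γ L zs).2 = ridge γ L zs from
    h.ham_ridgePoint h.zs_pos] at this

theorem saddle_mem_stable (h : Heights γ L zp zc zs) :
    ridgePoint γ L zs ∈ stableManifold (ham γ L) (ridgePoint γ L zs) :=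
  ⟨fun _ => ridgePoint γ L zs, rfl, isSolutionOn_saddle h _, tendsto_const_nhds⟩

theorem saddle_mem_unstable (h : Heights γ L zp zc zs) :
    ridgePoint γ L zs ∈ unstableManifold (ham γ L) (ridgePoint γ L zs) :=
  ⟨fun _ => ridgePoint γ L zs, rfl, isSolutionOn_saddle h _, tendsto_const_nhds⟩

theorem level_of_mem_stable (h : Heights γ L zp zc zs) {p : ℝ × ℝ}
    (hp : p ∈ stableManifold (ham γ L) (ridgePoint γ L zs)) :
    p ∈ phaseSpace ∧ ham γ L p.1 p.2 = ridge γ L zs := by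
  obtain ⟨ψ, rfl, hsol, hlim⟩ := hp
  refine ⟨(hsol 0 self_mem_Ici).1, tendsto_nhds_unique ?_ (h.continuousAt_saddle.comp hlim)⟩
  refine tendsto_const_nhds.congr' ?_
  filter_upwards [eventually_ge_atTop 0] with t ht
  exact (ham_eq_of_isSolutionOn (convex_Ici 0) hsol self_mem_Ici ht).symm

theorem level_of_mem_unstable (h : Heights γ L zp zc zs) {p : ℝ × ℝ}
    (hp : p ∈ unstableManifold (ham γ L) (ridgePoint γ L zs)) :
    p ∈ phaseSpace ∧ ham γ L p.1 p.2 = ridge γ L zs := by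
  obtain ⟨ψ, rfl, hsol, hlim⟩ := hp
  refine ⟨(hsol 0 self_mem_Iic).1, tendsto_nhds_unique ?_ (h.continuousAt_saddle.comp hlim)⟩
  refine tendsto_const_nhds.congr' ?_
  filter_upwards [eventually_le_atBot 0] with t ht
  exact (ham_eq_of_isSolutionOn (convex_Iic 0) hsol self_mem_Iic ht).symm

end Heights

namespace LoopSolution

theorem comp_add (hφ : LoopSolution γ L zp zs φ) (t₀ : ℝ) (S : Set ℝ) :
    IsSolutionOn (ham γ L) (fun t => φ (t + t₀)) S := by
  intro t _
  refine ⟨(hφ.mem _).1, ?_⟩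
  rw [hamField_ham (hφ.mem _).1]
  exact ((hφ.deriv (t + t₀)).comp_add_const t t₀).hasDerivWithinAt

theorem mem_stable (hφ : LoopSolution γ L zp zs φ) (h : Heights γ L zp zc zs) (t₀ : ℝ) :
    φ t₀ ∈ stableManifold (ham γ L) (ridgePoint γ L zs) :=
  ⟨fun t => φ (t + t₀), by simp, hφ.comp_add t₀ _,
    (hφ.tendsto_atTop h).comp (tendsto_atTop_add_const_right _ t₀ tendsto_id)⟩

theorem mem_unstable (hφ : LoopSolution γ L zp zs φ) (h : Heights γ L zp zc zs) (t₀ : ℝ) :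
    φ t₀ ∈ unstableManifold (ham γ L) (ridgePoint γ L zs) :=
  ⟨fun t => φ (t + t₀), by simp, hφ.comp_add t₀ _,
    (hφ.tendsto_atBot h).comp (tendsto_atBot_add_const_right _ t₀ tendsto_id)⟩

/-- Any set between the loop solution and the saddle level has the same part to the right of the
saddle, and apart from the saddle meets `∂H/∂x = 0` only in the ridge point of height `zp`. -/
theorem inter_eq_of_level (hφ : LoopSolution γ L zp zs φ) (h : Heights γ L zp zc zs)
    {W : Set (ℝ × ℝ)} (hW : ∀ p ∈ W, p ∈ phaseSpace ∧ ham γ L p.1 p.2 = ridge γ L zs)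
    (hs : ridgePoint γ L zs ∈ W) (hφW : ∀ t, φ t ∈ W) :
    W ∩ curveC1 (ham γ L) = {ridgePoint γ L zs, ridgePoint γ L zp} ∧
      W ∩ {p | (ridgePoint γ L zs).1 < p.1} = range φ := by
  constructor
  · ext p
    constructor
    · rintro ⟨hp, -, hp1⟩
      obtain ⟨hpp, hH⟩ := hW p hp
      exact h.eq_or_eq_of_level_of_c1 hpp hH ((partialX_ham_eq_zero_iff hpp).1 hp1)
    · rintro (rfl | rfl)
      · have hp := (hW _ hs).1
        exact ⟨hs, hp, (partialX_ham_eq_zero_iff hp).2 (h.ridgePoint_spec h.zs_pos)⟩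
      · have hp := (hφ.mem 0).1
        have hmem := hφW 0
        rw [hφ.init] at hp hmem
        exact ⟨hmem, hp, (partialX_ham_eq_zero_iff hp).2 (h.ridgePoint_spec h.zp_pos)⟩
  · ext p
    constructor
    · rintro ⟨hp, hlt⟩
      obtain ⟨hpp, hH⟩ := hW p hp
      rw [hφ.range_eq_loop h]
      exact ⟨hpp, hH, hlt⟩
    · rintro ⟨t, rfl⟩
      exact ⟨hφW t, (hφ.mem t).2.2⟩

end LoopSolution

/-! ### Accretion solutions on the loop -/

/-- A differentiable branch of the loop over a radial interval carries an accretion solution, whose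
velocity is read off from the particle flux. -/
theorem Heights.isAccretionSolution (h : Heights γ L zp zc zs) {a b : ℝ} {w : ℝ → ℝ}
    (hc : ContinuousOn w (Ioc a b)) (hd : DifferentiableOn ℝ w (Ioo a b))
    (hw : ∀ x ∈ Ioc a b, (x, w x) ∈ saddleLoop γ L zs) :
    IsAccretionSolution γ L (-√(ridge γ L zs)) (Ioc a b) w
      (fun x => -√(ridge γ L zs) / (x ^ 2 * w x)) := by
  have hE := Real.sqrt_pos.2 h.ridge_zs_pos
  have hx : ∀ x ∈ Ioc a b, 0 < x := fun x hx => (hw x hx).1.1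
  have hz : ∀ x ∈ Ioc a b, 0 < w x := fun x hx => (hw x hx).1.2
  have hne : ∀ x ∈ Ioc a b, x ^ 2 * w x ≠ 0 := fun x hxI =>
    (mul_pos (pow_pos (hx x hxI) 2) (hz x hxI)).ne'
  refine ⟨ordConnected_Ioc, hx, hz, fun x hxI => ?_, hc, ?_, ?_, ?_, fun x hxI => ?_,
    fun x hxI => ?_⟩
  · exact div_neg_of_neg_of_pos (neg_neg_of_pos hE) (mul_pos (pow_pos (hx x hxI) 2) (hz x hxI))
  · exact continuousOn_const.div ((continuousOn_id.pow 2).mul hc) hne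
  · rwa [interior_Ioc]
  · rw [interior_Ioc]
    exact (differentiableOn_const _).div ((differentiableOn_id.pow 2).mul hd)
      fun x hxI => hne x (Ioo_subset_Ioc_self hxI)
  · have := hx x hxI
    have := hz x hxI
    field_simp
  · have h1 := (hw x hxI).2.1
    have h2 := hx x hxI
    have h3 := hz x hxI
    have h4 : 0 < enthalpy γ (w x) := one_pos.trans (one_lt_enthalpy h3)
    rw [div_pow, neg_sq, Real.sq_sqrt h.ridge_zs_pos.le, ← h1]
    simp only [ham]
    field_simp
    ring

/-- The flux constant of an accretion solution is the value of the Hamiltonian along its graph. -/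
theorem IsAccretionSolution.ham_eq_sq {μ : ℝ} {I : Set ℝ} {w u : ℝ → ℝ}
    (hs : IsAccretionSolution γ L μ I w u) (hx : x ∈ I) : ham γ L x (w x) = μ ^ 2 := by
  have h2 := hs.radius_pos x hx
  have h3 := hs.density_pos x hx
  have h4 : 0 < enthalpy γ (w x) := one_pos.trans (one_lt_enthalpy h3)
  have h5 : L ^ 2 / enthalpy γ (w x) ^ 2 = 1 - 1 / x + u x ^ 2 := by
    rw [← hs.energy x hx]
    field_simp
  rw [ham, h5, ← hs.particle_flux x hx]
  ring

/-- The loop is the union of two branches over `(x_s, xmax]`: the part of the orbit up to the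
turning time of `x` and the part after it. -/
theorem LoopSolution.exists_branches (hφ : LoopSolution γ L zp zs φ) (h : Heights γ L zp zc zs) :
    ∃ xmax, (ridgePoint γ L zp).1 < xmax ∧ xmax < 1 / (1 - L ^ 2) ∧
      (∀ p ∈ saddleLoop γ L zs, p.1 ≤ xmax) ∧
      ∃ z₁ u₁ z₂ u₂ : ℝ → ℝ,
        IsAccretionSolution γ L (-√(ridge γ L zs)) (Ioc (ridgePoint γ L zs).1 xmax) z₁ u₁ ∧
        IsAccretionSolution γ L (-√(ridge γ L zs)) (Ioc (ridgePoint γ L zs).1 xmax) z₂ u₂ ∧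
        (∀ x ∈ Ioo (ridgePoint γ L zs).1 xmax, z₂ x < z₁ x) ∧ z₁ xmax = z₂ xmax ∧
        range φ = (fun x => (x, z₁ x)) '' Ioc (ridgePoint γ L zs).1 xmax ∪
          (fun x => (x, z₂ x)) '' Ioc (ridgePoint γ L zs).1 xmax := by
  obtain ⟨T, hT0, hT, hlt, hgt⟩ := hφ.exists_turning_time h
  have hmono : StrictMonoOn (fun t => (φ t).1) (Iic T) :=
    hφ.fst_strictMonoOn (convex_Iic T) fun t ht => hlt t (by rwa [interior_Iic] at ht)
  have hanti : StrictAntiOn (fun t => (φ t).1) (Ici T) :=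
    hφ.fst_strictAntiOn (convex_Ici T) fun t ht => hgt t (by rwa [interior_Ici] at ht)
  have hdne : ∀ t, (φ t).1 * kCurve γ L (φ t).2 ≠ 1 →
      2 * (φ t).1 ^ 3 * (φ t).2 * (1 - (φ t).1 * kCurve γ L (φ t).2) ≠ 0 := fun t ht => by
    have hx := hφ.fst_pos t
    have hz := hφ.snd_pos t
    exact mul_ne_zero (by positivity) (sub_ne_zero.2 ht.symm)
  have hsnd : Differentiable ℝ fun t => (φ t).2 := fun t => (hφ.hasDerivAt_snd t).differentiableAt
  obtain ⟨g₂, hg₂c, hg₂d, hg₂, hg₂'⟩ := exists_inverse_of_strictMonoOn_Iic hφ.hasDerivAt_fst hmono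
    (fun t ht => hdne t (hlt t ht).ne) ((continuous_fst.tendsto _).comp (hφ.tendsto_atBot h))
  obtain ⟨g₁, hg₁c, hg₁d, hg₁, hg₁'⟩ := exists_inverse_of_strictMonoOn_Iic
    (f := fun t => (φ (-t)).1) (T := -T)
    (fun t => (hφ.hasDerivAt_fst (-t)).scomp t (hasDerivAt_neg t))
    (fun s hs t ht hst => hanti (mem_Ici.2 (le_neg_of_le_neg ht)) (mem_Ici.2 (le_neg_of_le_neg hs))
      (neg_lt_neg hst))
    (fun t ht => smul_ne_zero (by norm_num) (hdne (-t) (hgt (-t) (lt_neg_of_lt_neg ht)).ne'))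
    (((continuous_fst.tendsto _).comp (hφ.tendsto_atTop h)).comp tendsto_neg_atBot_atTop)
  simp only [neg_neg] at hg₁c hg₁d hg₁ hg₁'
  have hpt₁ : ∀ x ∈ Ioc (ridgePoint γ L zs).1 (φ T).1, (x, (φ (-g₁ x)).2) = φ (-g₁ x) :=
    fun x hx => Prod.ext (hg₁ x hx).2.symm rfl
  have hpt₂ : ∀ x ∈ Ioc (ridgePoint γ L zs).1 (φ T).1, (x, (φ (g₂ x)).2) = φ (g₂ x) :=
    fun x hx => Prod.ext (hg₂ x hx).2.symm rfl
  have hxT : (φ T).1 ∈ Ioc (ridgePoint γ L zs).1 (φ T).1 := ⟨(hφ.mem T).2.2, le_rfl⟩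
  have hle : ∀ t, (φ t).1 ≤ (φ T).1 := fun t => by
    rcases le_total t T with ht | ht
    · exact (hg₂' t ht).1.2
    · simpa using (hg₁' (-t) (neg_le_neg ht)).1.2
  refine ⟨(φ T).1, ?_, h.lt_of_ham_eq (hφ.fst_pos T) (hφ.snd_pos T) (hφ.mem T).2.1, ?_,
    fun x => (φ (-g₁ x)).2, _, fun x => (φ (g₂ x)).2, _,
    h.isAccretionSolution (hsnd.continuous.comp_continuousOn hg₁c.neg)
      (hsnd.comp_differentiableOn hg₁d.neg) (fun x hx => hpt₁ x hx ▸ hφ.mem _),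
    h.isAccretionSolution (hsnd.continuous.comp_continuousOn hg₂c)
      (hsnd.comp_differentiableOn hg₂d) (fun x hx => hpt₂ x hx ▸ hφ.mem _), ?_, ?_, ?_⟩
  · rw [← hφ.init]
    exact hmono hT0.le self_mem_Iic hT0
  · rw [← hφ.range_eq_loop h]
    rintro _ ⟨t, rfl⟩
    exact hle t
  · -- the branches lie on different sides of the decreasing curve `∂H/∂z = 0`
    intro x hx
    have hx' := Ioo_subset_Ioc_self hx
    have hx0 : 0 < x := (h.ridgePoint_fst_pos h.zs_pos).trans hx.1
    obtain ⟨h1, h1x⟩ := hg₁ x hx'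
    obtain ⟨h2, h2x⟩ := hg₂ x hx'
    have h1T : T < -g₁ x := (le_neg_of_le_neg h1).lt_of_ne
      (by intro he; rw [← he] at h1x; exact hx.2.ne' h1x)
    have h2T : g₂ x < T := h2.lt_of_ne (by intro he; rw [he] at h2x; exact hx.2.ne' h2x)
    have h3 := (hlt _ h2T).trans (hgt _ h1T)
    rw [h1x, h2x] at h3
    exact (h.kCurve_strictMonoOn.lt_iff_lt (hφ.snd_pos _).le (hφ.snd_pos _).le).1
      (lt_of_mul_lt_mul_left h3 hx0.le)
  · have h1 := (hg₁' (-T) le_rfl).2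
    have h2 := (hg₂' T le_rfl).2
    simp only [neg_neg] at h1 h2
    simp only [h1, h2, neg_neg]
  · ext p
    constructor
    · rintro ⟨t, rfl⟩
      rcases le_total t T with ht | ht
      · obtain ⟨h1, h2⟩ := hg₂' t ht
        exact Or.inr ⟨(φ t).1, h1, by simp only [h2]⟩
      · obtain ⟨h1, h2⟩ := hg₁' (-t) (neg_le_neg ht)
        simp only [neg_neg] at h1 h2
        exact Or.inl ⟨(φ t).1, h1, by simp only [h2, neg_neg]⟩
    · rintro (⟨x, hx, rfl⟩ | ⟨x, hx, rfl⟩)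
      · exact ⟨_, (hpt₁ x hx).symm⟩
      · exact ⟨_, (hpt₂ x hx).symm⟩

end Michel

end

theorem mainTheorem3 (γ L : ℝ) (hγ : 5 / 3 < γ) (hγ' : γ ≤ 2) (hL : 0 < L)
    (hmin : Michel.Lmin γ ^ 2 < L ^ 2) (hL1 : L ^ 2 < 1) :
    ∃ s c : ℝ × ℝ,
      -- exactly two critical points, a saddle `s` and a center `c`
      Michel.criticalPoints (Michel.ham γ L) = {s, c} ∧
      Michel.IsSaddle (Michel.ham γ L) s ∧ Michel.IsCenter (Michel.ham γ L) c ∧ s.1 < c.1 ∧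
      -- both invariant manifolds of the saddle are bounded in `x`
      (∀ p ∈ Michel.stableManifold (Michel.ham γ L) s ∪
          Michel.unstableManifold (Michel.ham γ L) s, p.1 ≤ 1 / (1 - L ^ 2)) ∧
      ∃ (P : ℝ × ℝ) (φ : ℝ → ℝ × ℝ) (xmax : ℝ),
        -- apart from `s`, both of them meet `c₁` exactly in the same point `P`
        c.1 < P.1 ∧
        Michel.stableManifold (Michel.ham γ L) s ∩ Michel.curveC1 (Michel.ham γ L) = {s, P} ∧
        Michel.unstableManifold (Michel.ham γ L) s ∩ Michel.curveC1 (Michel.ham γ L) = {s, P} ∧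
        -- they join into a homoclinic orbit, which crosses `c₁` at `P`
        Michel.IsHomoclinic (Michel.ham γ L) s φ ∧ φ 0 = P ∧
        (∀ t < 0, 0 < Michel.partialX (Michel.ham γ L) (φ t).1 (φ t).2) ∧
        (∀ t > 0, Michel.partialX (Michel.ham γ L) (φ t).1 (φ t).2 < 0) ∧
        Michel.stableManifold (Michel.ham γ L) s ∩ {p | s.1 < p.1} = range φ ∧
        Michel.unstableManifold (Michel.ham γ L) s ∩ {p | s.1 < p.1} = range φ ∧
        -- the homoclinic orbit consists of the graphs of two accretion solutions on `(s.1, xmax]`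
        c.1 < xmax ∧ xmax < 1 / (1 - L ^ 2) ∧
        (∃ z₁ u₁ z₂ u₂ : ℝ → ℝ,
          Michel.IsAccretionSolution γ L (-√(Michel.ham γ L s.1 s.2)) (Ioc s.1 xmax) z₁ u₁ ∧
          Michel.IsAccretionSolution γ L (-√(Michel.ham γ L s.1 s.2)) (Ioc s.1 xmax) z₂ u₂ ∧
          (∀ x ∈ Ioo s.1 xmax, z₂ x < z₁ x) ∧ z₁ xmax = z₂ xmax ∧
          range φ = (fun x => (x, z₁ x)) '' Ioc s.1 xmax ∪ (fun x => (x, z₂ x)) '' Ioc s.1 xmax) ∧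
        -- accretion solutions through a point of the manifolds are local, hence not global
        (∀ (μ : ℝ) (I : Set ℝ) (z u : ℝ → ℝ), Michel.IsAccretionSolution γ L μ I z u →
          (∃ x ∈ I, (x, z x) ∈ Michel.stableManifold (Michel.ham γ L) s ∪
            Michel.unstableManifold (Michel.ham γ L) s) →
          I ⊆ Iic xmax ∧ ¬ Ioi 1 ⊆ I) := by
  obtain ⟨zp, zc, zs, h⟩ := (Michel.Admissible.mk hγ hγ' hL hmin hL1).exists_heights
  obtain ⟨φ, hφ0, hφ'⟩ := h.exists_loop_solution
  have hφ : Michel.LoopSolution γ L zp zs φ := ⟨hφ0, fun t => (hφ' t).1, fun t => (hφ' t).2⟩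
  obtain ⟨xmax, hPx, hxb, hxle, hbranch⟩ := hφ.exists_branches h
  obtain ⟨hs1, hs2⟩ := hφ.inter_eq_of_level h (fun p hp => h.level_of_mem_stable hp)
    h.saddle_mem_stable (hφ.mem_stable h)
  obtain ⟨hu1, hu2⟩ := hφ.inter_eq_of_level h (fun p hp => h.level_of_mem_unstable hp)
    h.saddle_mem_unstable (hφ.mem_unstable h)
  have hlevel : ∀ p ∈ Michel.stableManifold (Michel.ham γ L) (Michel.ridgePoint γ L zs) ∪
      Michel.unstableManifold (Michel.ham γ L) (Michel.ridgePoint γ L zs),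
      p ∈ Michel.phaseSpace ∧ Michel.ham γ L p.1 p.2 = Michel.ridge γ L zs := fun p hp =>
    hp.elim h.level_of_mem_stable h.level_of_mem_unstable
  have hcx : (Michel.ridgePoint γ L zc).1 < (Michel.ridgePoint γ L zp).1 :=
    h.ridgePoint_fst_lt h.zp_pos h.zp_lt_zc
  have hE : Michel.ham γ L (Michel.ridgePoint γ L zs).1 (Michel.ridgePoint γ L zs).2 =
      Michel.ridge γ L zs := h.ham_ridgePoint h.zs_pos
  refine ⟨Michel.ridgePoint γ L zs, Michel.ridgePoint γ L zc, h.criticalPoints_eq, h.isSaddle,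
    h.isCenter, h.ridgePoint_fst_lt h.zc_pos h.zc_lt_zs, fun p hp => ?_,
    Michel.ridgePoint γ L zp, φ, xmax, hcx, hs1, hu1,
    ⟨hφ.isSolutionOn _, fun t ht => ?_, hφ.tendsto_atBot h, hφ.tendsto_atTop h⟩, hφ0,
    fun t ht => (Michel.partialX_ham_pos_iff (hφ.mem t).1).2 (hφ.c1_of_neg h ht),
    fun t ht => (Michel.partialX_ham_neg_iff (hφ.mem t).1).2 (hφ.c1_of_pos h ht),
    hs2, hu2, hcx.trans hPx, hxb, ?_, fun μ I w u hsol hI => ?_⟩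
  · obtain ⟨hpp, hH⟩ := hlevel p hp
    exact (h.lt_of_ham_eq hpp.1 hpp.2 hH).le
  · exact (hφ.mem t).2.2.ne' (congrArg Prod.fst ht)
  · rw [hE]
    exact hbranch
  · obtain ⟨x₀, hx₀, hmem⟩ := hI
    have hμ : Michel.ridge γ L zs = μ ^ 2 := by
      rw [← (hlevel _ hmem).2]
      exact hsol.ham_eq_sq hx₀
    have hsx : (Michel.ridgePoint γ L zs).1 < xmax :=
      (h.ridgePoint_fst_lt h.zp_pos (h.zp_lt_zc.trans h.zc_lt_zs)).trans hPx
    -- the whole graph lies on the saddle level, which contains no point beyond `xmax`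
    have hsub : I ⊆ Iic xmax := by
      intro x hx
      by_contra hcon
      have hlt : xmax < x := not_le.1 hcon
      have hloop : (x, w x) ∈ Michel.saddleLoop γ L zs :=
        ⟨⟨hsol.radius_pos x hx, hsol.density_pos x hx⟩, (hsol.ham_eq_sq hx).trans hμ.symm,
          hsx.trans hlt⟩
      exact hcon (hxle _ hloop)
    refine ⟨hsub, fun hsup => ?_⟩
    have hpos : 0 < xmax := (h.ridgePoint_fst_pos h.zs_pos).trans hsx
    have hle : xmax + 1 ≤ xmax := hsub (hsup (show (1 : ℝ) < xmax + 1 by linarith))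
    linarith
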